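/- **Conventions.** Let $\mathbb I=[0,1]$. Let $\square$ be the category with objects $[1]^n$ ($n\ge 0$, $[1]=\{0<1\}$) whose morphisms are the maps generated, under composition and Cartesian product, by the two inclusions $[0]\to[1]$, the projection $[1]\to[0]$ and the supremum $\vee:[1]^2\to[1]$. A *cubical set* is a functor $C:\square^{op}\to\mathbf{Set}$. A $\square$-morphism $[1]^m\to[1]^n$ extends to the map $\mathbb I^m\to\mathbb I^n$ that is linear on the convex hull of each chain of $[1]^m$. The *topological realization* $|C|$ of $C$ is the colimit, over the cubes of $C$, of the topological cubes $\mathbb I^n$. Its *geometric realization* is the colimit of the same diagram in the category of extended metric spaces and $1$-Lipschitz maps, each $\mathbb I^n$ having the sup metric. Let $\mathbf{Unif}$ be the category whose objects are the separated uniform spaces that are colimits, in the category of all uniform spaces and uniformly continuous maps, of small diagrams of connected, locally connected metric spaces, and whose morphisms are all uniformly continuous maps. The *uniform realization* $|C|_\infty$ is the coreflection in $\mathbf{Unif}$ of the uniform space underlying the geometric realization of $C$: the same set, with the finest uniformity for which all uniformly continuous maps to it from connected, locally connected metric spaces remain uniformly continuous. A continuous map $f:X\to Y$ is a *classical weak equivalence*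 if for every cubical set $D$ it induces a bijection from homotopy classes of continuous maps $|D|\to X$ to homotopy classes of continuous maps $|D|\to Y$. **Proposition.** The category $\mathbf{Unif}$ is Cartesian closed. For objects $A,X$ let $\mathbf{Unif}(A,X)$ be the topological space underlying the exponential object $X^A$ (its points are the morphisms $A\to X$). Call a morphism $f:X\to Y$ of $\mathbf{Unif}$ - a *uniform weak equivalence* if $\mathbf{Unif}(|C|_\infty,f):\mathbf{Unif}(|C|_\infty,X)\to\mathbf{Unif}(|C|_\infty,Y)$ is a classical weak equivalence for every cubical set $C$; - a *uniform Hurewicz fibration* if, for every object $A$ of $\mathbf{Unif}$, the map $\mathbf{Unif}(A,f):\mathbf{Unif}(A,X)\to\mathbf{Unif}(A,Y)$ has the right lifting property with respect to $\{0\}\hookrightarrow\mathbb I$. Then $\mathbf{Unif}$ is a category of fibrant objects whose weak equivalences are the uniform weak equivalences and whose fibrations are the uniform Hurewicz fibrations. That is: 1. $\mathbf{Unif}$ has all finite limits; 2. the isomorphisms are weak equivalences, and if two of $f$, $g$, $gf$ are weak equivalences then so is the third; 3. the isomorphisms are fibrations, and fibrations are closed under composition; 4. each diagonal $X\to X\times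 X$ factors as a weak equivalence followed by a fibration; 5. each morphism from an object to the terminal object is a fibration; 6. fibrations are closed under pullback; 7. morphisms that are both fibrations and weak equivalences are closed under pullback. -/

import Mathlib

open CategoryTheory Limits Opposite
open scoped unitInterval ENNReal

universe u v w

namespace UniformHomotopy

/-! ### The site of cubes with one type of connection, and cubical sets -/

/-- The tensor (Cartesian product) of two maps between powers of the poset `[1] = {0 < 1}`. -/
def tensorMap {m n m' n' : ℕ} (f : (Fin m → Bool) → (Fin n → Bool))
    (g : (Fin m' → Bool) → (Fin n' → Bool)) : (Fin (m + m') → Bool) → (Fin (n + n') → Bool) :=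
  fun x => Fin.append (f fun i => x (Fin.castAdd m' i)) (g fun i => x (Fin.natAdd m i))

/-- The maps `[1]^m → [1]^n` that are generated, under composition and tensor, by the two
inclusions `[0] → [1]`, the projection `[1] → [0]` and the supremum `[1]^2 → [1]`. -/
inductive IsCubeMap : ∀ {m n : ℕ}, ((Fin m → Bool) → (Fin n → Bool)) → Prop
  | id (n : ℕ) : IsCubeMap (fun x : Fin n → Bool => x)
  | comp {l m n : ℕ} {f : (Fin l → Bool) → (Fin m → Bool)} {g : (Fin m → Bool) → (Fin n → Bool)} :
      IsCubeMap f → IsCubeMap g → IsCubeMap (fun x => g (f x))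
  | tensor {m n m' n' : ℕ} {f : (Fin m → Bool) → (Fin n → Bool)}
      {g : (Fin m' → Bool) → (Fin n' → Bool)} :
      IsCubeMap f → IsCubeMap g → IsCubeMap (tensorMap f g)
  | face (b : Bool) : IsCubeMap (fun (_ : Fin 0 → Bool) (_ : Fin 1) => b)
  | degeneracy : IsCubeMap (fun (_ : Fin 1 → Bool) (i : Fin 0) => i.elim0)
  | connection : IsCubeMap (fun (x : Fin 2 → Bool) (_ : Fin 1) => x 0 || x 1)

/-- The cube category: the object of dimension `n` is `[1]^n`. -/
structure CubeCat : Type where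
  dim : ℕ

instance : Category.{0} CubeCat where
  Hom a b := { φ : (Fin a.dim → Bool) → (Fin b.dim → Bool) // IsCubeMap φ }
  id a := ⟨fun x => x, IsCubeMap.id a.dim⟩
  comp f g := ⟨fun x => g.1 (f.1 x), IsCubeMap.comp f.2 g.2⟩

/-- Cubical sets. -/
abbrev CubicalSet : Type (u + 1) := CubeCatᵒᵖ ⥤ Type u

/-! ### Topological and geometric realization -/

/-- The extension of a monotone map `[1]^m → [1]^n` to a map `I^m → I^n` that is linear on the
convex hull of every chain of `[1]^m`.  If `x = ∑ k, λ k • v k` with `v 0 ≤ v 1 ≤ ⋯`, then the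
`j`-th coordinate below is the sum of those `λ k` for which `φ (v k) j = 1`. -/
def cubeExt {m n : ℕ} (φ : (Fin m → Bool) → (Fin n → Bool)) (x : Fin m → I) : Fin n → I :=
  fun j => (Finset.univ.filter fun v : Fin m → Bool => φ v j = true).sup
    fun v => (Finset.univ.filter fun i : Fin m => v i = true).inf x

/-- The points of the disjoint union of one topological `n`-cube for every `n`-cube of `C`. -/
abbrev CubePoints (C : CubicalSet.{u}) : Type u :=
  Σ n : ℕ, Σ _ : C.obj (op ⟨n⟩), (Fin n → I)

/-- The identifications made in the realization of `C`. -/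
inductive Glue (C : CubicalSet.{u}) : CubePoints C → CubePoints C → Prop
  | mk {m n : ℕ} (φ : CubeCat.mk m ⟶ CubeCat.mk n) (c : C.obj (op ⟨n⟩)) (x : Fin m → I) :
      Glue C ⟨m, C.map φ.op c, x⟩ ⟨n, c, cubeExt φ.1 x⟩

/-- The topological realization `|C|`: the colimit of the topological cubes over the cubes
of `C`, with the quotient topology. -/
def TopRealization (C : CubicalSet.{u}) : Type u := Quot (Glue C)

instance (C : CubicalSet.{u}) : TopologicalSpace (TopRealization C) :=
  inferInstanceAs (TopologicalSpace (Quot (Glue C)))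

/-- Extended pseudometrics on the disjoint union of the cubes of `C` for which each cube
`I^n` (with the sup metric) is mapped in by a `1`-Lipschitz map, and for which points that are
identified in the realization have distance `0`. -/
structure IsCubeMetric (C : CubicalSet.{u}) (ρ : CubePoints C → CubePoints C → ℝ≥0∞) : Prop where
  self : ∀ p, ρ p p = 0
  symm : ∀ p q, ρ p q = ρ q p
  triangle : ∀ p q r, ρ p r ≤ ρ p q + ρ q r
  lipschitz : ∀ (n : ℕ) (c : C.obj (op ⟨n⟩)) (x y : Fin n → I),
    ρ ⟨n, c, x⟩ ⟨n, c, y⟩ ≤ edist x y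
  glue : ∀ p q, Glue C p q → ρ p q = 0

/-- The disjoint union of the cubes of `C`, with the largest extended pseudometric as above.
Up to identification of points at distance `0` this is the colimit of the cubes over the cubes of
`C`, in extended pseudometric spaces and `1`-Lipschitz maps. -/
def PreGeom (C : CubicalSet.{u}) : Type u := CubePoints C

noncomputable instance (C : CubicalSet.{u}) : PseudoEMetricSpace (PreGeom C) where
  edist p q := ⨆ ρ : { ρ : CubePoints C → CubePoints C → ℝ≥0∞ // IsCubeMetric C ρ }, ρ.1 p q
  edist_self p := by simp [fun ρ : { ρ // IsCubeMetric C ρ } => ρ.2.self p]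
  edist_comm p q := iSup_congr fun ρ => ρ.2.symm p q
  edist_triangle p q r := iSup_le fun ρ => (ρ.2.triangle p q r).trans
    (add_le_add (le_iSup (fun ρ : { ρ // IsCubeMetric C ρ } => ρ.1 p q) ρ)
      (le_iSup (fun ρ : { ρ // IsCubeMetric C ρ } => ρ.1 q r) ρ))

/-- The geometric realization of `C`: the colimit of the cubes `I^n` over the cubes of `C`, in
extended metric spaces and `1`-Lipschitz maps. -/
def GeomRealization (C : CubicalSet.{u}) : Type u := SeparationQuotient (PreGeom C)

noncomputable instance (C : CubicalSet.{u}) : EMetricSpace (GeomRealization C) :=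
  inferInstanceAs (EMetricSpace (SeparationQuotient (PreGeom C)))

/-! ### The category of uniform spaces -/

/-- The uniform space `X` underlies a connected, locally connected metric space. -/
def IsConnMetric (X : UniformSpaceCat.{u}) : Prop :=
  ConnectedSpace X ∧ LocallyConnectedSpace X ∧
    ∃ d : MetricSpace X, d.toPseudoMetricSpace.toUniformSpace = X.str

/-- Separated uniform spaces that are colimits, in the category of all uniform spaces and uniform
maps, of (small) diagrams of connected, locally connected metric spaces. -/
def unifProp : ObjectProperty UniformSpaceCat.{u} := fun X =>
  T0Space X ∧ ∃ (J : Type u) (_ : SmallCategory J) (F : J ⥤ UniformSpaceCat.{u})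
    (ι : F ⟶ (Functor.const J).obj X), (∀ j, IsConnMetric (F.obj j)) ∧
      Nonempty (IsColimit (Cocone.mk X ι))

/-- The category `Unif`, with all uniform maps between such spaces as morphisms. -/
abbrev Unif : Type (u + 1) := unifProp.{u}.FullSubcategory

/-- The continuous map of underlying spaces of a uniform map. -/
def Unif.toMap {X Y : Unif.{u}} (f : X ⟶ Y) : C(X.obj, Y.obj) :=
  ⟨f.hom, f.hom.hom.2.continuous⟩

/-- The set `X` with the final uniformity for all uniform maps to `X` from connected, locally
connected metric spaces. -/
def Corefl (X : Type u) : Type u := X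

/-- The finest uniformity for which all uniform maps from connected, locally connected metric
spaces to `X` remain uniform. -/
instance (X : Type u) [UX : UniformSpace X] : UniformSpace (Corefl X) :=
  sInf { U : UniformSpace X | ∀ (M : UniformSpaceCat.{u}) (g : M → X), IsConnMetric M →
    @UniformContinuous M X M.str UX g → @UniformContinuous M X M.str U g }

section Coreflection

variable (X : Type u) [UX : UniformSpace X]

theorem Corefl.uniformContinuous_id : @UniformContinuous (Corefl X) X _ UX id :=
  uniformContinuous_iff_le_comap.2 <|
    (sInf_le (fun _ _ _ h => h)).trans_eq (congrFun uniformSpace_comap_id UX).symm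

theorem Corefl.uniformContinuous_test (M : UniformSpaceCat.{u}) (g : M → X) (hM : IsConnMetric M)
    (hg : UniformContinuous g) : @UniformContinuous M (Corefl X) _ _ g :=
  uniformContinuous_sInf_rng.2 fun _ hU => hU M g hM hg

theorem Corefl.uniformContinuous_of_test {Z : Type w} [UZ : UniformSpace Z] (f : X → Z)
    (h : ∀ (M : UniformSpaceCat.{u}) (g : M → X), IsConnMetric M → UniformContinuous g →
      UniformContinuous (f ∘ g)) : @UniformContinuous (Corefl X) Z _ _ f :=
  uniformContinuous_iff_le_comap.2 <|
    sInf_le fun M g hM hg => uniformContinuous_comap' (h M g hM hg)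

instance [T0Space X] : T0Space (Corefl X) :=
  @t0Space_of_injective_of_continuous (Corefl X) X _ _ id Function.injective_id
    (@UniformContinuous.continuous (Corefl X) X _ UX id (Corefl.uniformContinuous_id X)) _

theorem isConnMetric_punit : IsConnMetric (UniformSpaceCat.of PUnit.{u + 1}) :=
  ⟨inferInstanceAs (ConnectedSpace PUnit), inferInstanceAs (LocallyConnectedSpace PUnit),
    inferInstanceAs (MetricSpace PUnit), rfl⟩

/-- The uniformities on `X` for which some test map is not uniform. -/
abbrev BadUnif : Type u := { U : UniformSpace X // ∃ (M : UniformSpaceCat.{u}) (g : M → X),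
  IsConnMetric M ∧ @UniformContinuous M X M.str UX g ∧ ¬ @UniformContinuous M X M.str U g }

/-- A small family of test maps that detects the uniformity of `Corefl X`. -/
noncomputable def Corefl.test : X ⊕ BadUnif X → Over (UniformSpaceCat.of (Corefl X))
  | Sum.inl x => Over.mk (Y := UniformSpaceCat.of PUnit.{u + 1})
      (UniformSpaceCat.ofHom ⟨fun _ => (x : Corefl X), uniformContinuous_const⟩)
  | Sum.inr U => Over.mk (Y := U.2.choose)
      (UniformSpaceCat.ofHom ⟨U.2.choose_spec.choose, Corefl.uniformContinuous_test X _ _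
        U.2.choose_spec.choose_spec.1 U.2.choose_spec.choose_spec.2.1⟩)

/-- The small category of these test maps, with all uniform maps over `X`. -/
structure Corefl.Index : Type u where
  val : X ⊕ BadUnif X

noncomputable instance : SmallCategory (Corefl.Index X) :=
  inferInstanceAs (Category (InducedCategory _ fun j : Corefl.Index X => Corefl.test X j.val))

/-- The test spaces. -/
noncomputable def Corefl.diagram : Corefl.Index X ⥤ UniformSpaceCat.{u} :=
  inducedFunctor (fun j : Corefl.Index X => Corefl.test X j.val) ⋙ Over.forget _

/-- The inclusion of a point into a test space. -/
noncomputable def Corefl.pt (j : Corefl.Index X) (m : (Corefl.test X j.val).left) :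
    (⟨Sum.inl ((Corefl.test X j.val).hom m)⟩ : Corefl.Index X) ⟶ j :=
  InducedCategory.homMk (Over.homMk
    (U := Corefl.test X (Sum.inl ((Corefl.test X j.val).hom m))) (V := Corefl.test X j.val)
    (UniformSpaceCat.ofHom (X := PUnit) ⟨fun _ => m, uniformContinuous_const⟩) rfl)

theorem unifProp_corefl [T0Space X] : unifProp (UniformSpaceCat.of (Corefl X)) := by
  refine ⟨inferInstanceAs (T0Space (Corefl X)), Corefl.Index X, inferInstance, Corefl.diagram X,
    { app := fun j => (Corefl.test X j.val).hom, naturality := fun i j f => ?_ }, ?_, ⟨?_⟩⟩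
  · exact Over.w f.hom
  · rintro ⟨x | U⟩
    · exact isConnMetric_punit
    · exact U.2.choose_spec.choose_spec.1
  · have key : ∀ (s : Cocone (Corefl.diagram X)) (j : Corefl.Index X)
        (m : (Corefl.test X j.val).left),
        s.ι.app ⟨Sum.inl ((Corefl.test X j.val).hom m)⟩ PUnit.unit = s.ι.app j m := fun s j m =>
      (ConcreteCategory.congr_hom (s.w (Corefl.pt X j m)) PUnit.unit).symm
    let d : ∀ s : Cocone (Corefl.diagram X), X → s.pt :=
      fun s x => s.ι.app ⟨Sum.inl x⟩ PUnit.unit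
    have hd : ∀ s, @UniformContinuous (Corefl X) s.pt _ _ (d s) := by
      intro s
      refine uniformContinuous_iff_le_comap.2 (sInf_le fun M g hM hg => ?_)
      by_contra hn
      let U : BadUnif X := ⟨UniformSpace.comap (d s) s.pt.str, M, g, hM, hg, hn⟩
      refine U.2.choose_spec.choose_spec.2.2 (uniformContinuous_comap' ?_)
      have : d s ∘ U.2.choose_spec.choose = s.ι.app ⟨Sum.inr U⟩ :=
        funext fun m => key s ⟨Sum.inr U⟩ m
      rw [this]
      exact (s.ι.app ⟨Sum.inr U⟩).hom.2
    exact
      { desc := fun s => UniformSpaceCat.ofHom (X := Corefl X) ⟨d s, hd s⟩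
        fac := fun s j => UniformSpaceCat.hom_ext (funext fun m => key s j m)
        uniq := fun s f hf => UniformSpaceCat.hom_ext (funext fun x =>
          ConcreteCategory.congr_hom (hf ⟨Sum.inl x⟩) PUnit.unit) }

end Coreflection

/-- The coreflection in `Unif` of a separated uniform space. -/
def Unif.corefl (X : Type u) [UniformSpace X] [T0Space X] : Unif.{u} :=
  ⟨UniformSpaceCat.of (Corefl X), unifProp_corefl X⟩

/-- The uniform realization of a cubical set: the coreflection in `Unif` of the uniform space
that underlies the geometric realization. -/
noncomputable def uniformRealization (C : CubicalSet.{u}) : Unif.{u} :=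
  Unif.corefl (GeomRealization C)

/-! ### Weak equivalences, fibrations, categories of fibrant objects -/

/-- The set of homotopy classes of continuous maps `A → X`, that is, the set of path components
of the mapping space. -/
def HomotopyClasses (A : Type v) (X : Type w) [TopologicalSpace A] [TopologicalSpace X] :
    Type (max v w) :=
  Quotient (⟨ContinuousMap.Homotopic, ContinuousMap.Homotopic.equivalence⟩ : Setoid C(A, X))

/-- Postcomposition with a continuous map on homotopy classes. -/
def HomotopyClasses.postcomp (A : Type v) {X Y : Type w} [TopologicalSpace A] [TopologicalSpace X]
    [TopologicalSpace Y] (f : C(X, Y)) : HomotopyClasses A X → HomotopyClasses A Y :=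
  Quotient.map f.comp fun _ _ h => (ContinuousMap.Homotopic.refl f).comp h

/-- Classical weak equivalences: continuous maps that induce bijections on homotopy classes of
maps from the topological realization of every cubical set. -/
def IsClassicalWeakEquiv {X Y : Type u} [TopologicalSpace X] [TopologicalSpace Y]
    (f : C(X, Y)) : Prop :=
  ∀ D : CubicalSet.{u}, Function.Bijective (HomotopyClasses.postcomp (TopRealization D) f)

/-- The right lifting property of a continuous map with respect to `{0} ⊆ I`. -/
def LiftsPaths {X Y : Type u} [TopologicalSpace X] [TopologicalSpace Y] (f : C(X, Y)) : Prop :=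
  ∀ (γ : C(I, Y)) (x : X), f x = γ 0 → ∃ γ' : C(I, X), γ' 0 = x ∧ f.comp γ' = γ

section CartesianClosed

variable [CartesianMonoidalCategory Unif.{u}] [MonoidalClosed Unif.{u}]

/-- The map of spaces `Unif(A, X) → Unif(A, Y)` induced by `f : X → Y`, where `Unif(A, X)` is the
underlying space of the exponential object `X ^ A`. -/
def homMap (A : Unif.{u}) {X Y : Unif.{u}} (f : X ⟶ Y) :
    C(((ihom A).obj X).obj, ((ihom A).obj Y).obj) :=
  Unif.toMap ((ihom A).map f)

/-- Uniform weak equivalences. -/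
def uniformWeakEquivalences : MorphismProperty Unif.{u} := fun _ _ f =>
  ∀ C : CubicalSet.{u}, IsClassicalWeakEquiv (homMap (uniformRealization C) f)

/-- Uniform Hurewicz fibrations. -/
def uniformHurewiczFibrations : MorphismProperty Unif.{u} := fun _ _ f =>
  ∀ A : Unif.{u}, LiftsPaths (homMap A f)

end CartesianClosed

/-- `C` is a category of fibrant objects, with weak equivalences `W` and fibrations `F`. -/
structure IsCategoryOfFibrantObjects (C : Type u) [Category.{v} C] (W F : MorphismProperty C) :
    Prop where
  hasFiniteLimits : HasFiniteLimits C
  weq_of_isIso : ∀ {X Y : C} (f : X ⟶ Y), IsIso f → W f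
  fib_of_isIso : ∀ {X Y : C} (f : X ⟶ Y), IsIso f → F f
  fib_comp : F.IsStableUnderComposition
  twoOutOfThree : W.HasTwoOutOfThreeProperty
  factor_diag : ∀ X : C, ∃ (P : C) (i : X ⟶ P) (p : P ⟶ X ⨯ X),
    W i ∧ F p ∧ i ≫ p = diag X
  fib_terminal : ∀ X : C, F (terminal.from X)
  fib_baseChange : F.IsStableUnderBaseChange
  acyclicFib_baseChange : (F ⊓ W).IsStableUnderBaseChange

end UniformHomotopy

/-!
An object of `Unif` carries the final uniformity for the uniformly continuous maps to it from test
spaces, that is, from connected, locally connected metric spaces. So everything can be checked along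
test spaces: limits and exponentials are the coreflections of the evident sets of points, and a map
to `X ^ A` is uniformly continuous if and only if it is jointly uniformly continuous along test
spaces (`Unif.uniformContinuous_exp_iff`).

*Cartesian closedness.* The uniformity of `X ^ A` is final for the families of morphisms
parametrized by test spaces `M` that are jointly uniformly continuous. The point is that evaluation
is uniformly continuous along a uniformly continuous map `p : K → X ^ A` from a test space, although
`p` need not be such a family (`uniformContinuous_eval_pseudoMetric`). If the maps `p k` were not
uniformly equicontinuous, there would be closer and closer pairs `(aₙ, bₙ)` and functions `uₙ` on
`X ^ A`, measuring the variation of a map between `aₙ` and `bₙ`, such that almost all `uₙ` vanish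
along each family but all `uₙ ∘ p` from some `n` on are nonconstant. Then `(φₙ uₙ)` is uniformly
continuous to `ℕ → ℝ`, with the uniformity of uniform convergence, for *all* weights `φ`. But since
`K` is connected, `uₙ ∘ p` takes distinct values at arbitrarily close points, and suitable weights
contradict the uniform continuity of `p`.

*Mapping spaces.* Cubes are compact test spaces, on which continuity and uniform continuity agree.
Hence continuous maps from the topological realization of `D` to `X ^ A` are the points of
`X ^ (A ⊗ B)` for an object `B = fineRealization D`, and homotopies are paths (`mapEquiv`,
`homotopic_iff_joined`). So weak equivalences are detected on path components of exponential
objects, and the path lifting that defines fibrations, being required for all exponents, implies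
lifting of homotopies for maps from realizations.

*Path objects.* The exponential by the interval is a path object: its paths contract to their
starting points, and the fibration property of evaluation at the end points is the filling of a
square from three of its sides.

*Acyclic fibrations.* What has to be shown for base change is that paths in `Y ^ (A ⊗ B)` lift along
an acyclic fibration with prescribed end points (`exists_lift_path`). This is Dold's argument for
fibre homotopy equivalences. The homotopy inverse is replaced by a natural way to lift singular
cubes of `Y ^ A`; bijectivity on homotopy classes of maps from the realizations of the cubical sets
of singular cubes of `Y ^ A` and `X ^ A` provides it and the required natural homotopy. No cell
structure on realizations is needed.
-/

namespace UniformHomotopy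

section Evaluation

open Filter Topology Uniformity
open scoped SetRel

/-! ### Uniform continuity of evaluations -/

/-- The uniformity of a uniform space is the infimum of the coarser pseudometric uniformities. -/
theorem uniformContinuous_of_forall_pseudoMetric {K : Type v} {Z : Type w} [UniformSpace K]
    [UZ : UniformSpace Z] (f : K → Z)
    (h : ∀ d : PseudoMetricSpace Z, UZ ≤ d.toUniformSpace →
      @UniformContinuous K Z _ d.toUniformSpace f) : UniformContinuous f := by
  intro V hV
  -- Halve `V` repeatedly: the resulting sequence of entourages is a basis of a coarser uniformity,
  -- which is pseudometrizable because it is countably generated.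
  have step : ∀ W : {W : SetRel Z Z // W ∈ 𝓤 Z ∧ W.IsSymm},
      ∃ W' : {W : SetRel Z Z // W ∈ 𝓤 Z ∧ W.IsSymm}, W'.1 ○ W'.1 ⊆ W.1 := by
    rintro ⟨W, hW, -⟩
    obtain ⟨W', h1, h2, h3⟩ := comp_symm_mem_uniformity_sets hW
    exact ⟨⟨W', h1, h2⟩, h3⟩
  choose half hhalf using step
  obtain ⟨V₀, hV₀, hsymm, hV₀V⟩ := symm_of_uniformity hV
  let W : ℕ → {W : SetRel Z Z // W ∈ 𝓤 Z ∧ W.IsSymm} := fun n => half^[n] ⟨V₀, hV₀, hsymm⟩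
  have hW : ∀ n, (W (n + 1)).1 ○ (W (n + 1)).1 ⊆ (W n).1 := fun n => by
    simp only [W, Function.iterate_succ_apply']
    exact hhalf _
  have hanti : Antitone fun n => (W n).1 := antitone_nat_of_succ_le fun n q hq =>
    hW n ⟨q.2, hq, refl_mem_uniformity (W (n + 1)).2.1⟩
  have hb : (⨅ n, 𝓟 (W n).1).HasBasis (fun _ => True) fun n => (W n).1 :=
    hasBasis_iInf_principal hanti.directed_ge
  let c : UniformSpace.Core Z := UniformSpace.Core.mk' (⨅ n, 𝓟 (W n).1)
    (fun r hr x => by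
      obtain ⟨n, -, hn⟩ := hb.mem_iff.1 hr
      exact hn (refl_mem_uniformity (W n).2.1))
    (fun r hr => by
      obtain ⟨n, -, hn⟩ := hb.mem_iff.1 hr
      exact hb.mem_iff.2 ⟨n, trivial, fun q hq => hn ((W n).2.2.symm _ _ hq)⟩)
    (fun r hr => by
      obtain ⟨n, -, hn⟩ := hb.mem_iff.1 hr
      exact ⟨_, hb.mem_of_mem (i := n + 1) trivial, (hW n).trans hn⟩)
  let U : UniformSpace Z := UniformSpace.ofCore c
  have hU : UZ ≤ U := (le_iInf fun n => le_principal_iff.2 (W n).2.1 : @uniformity Z UZ ≤ ⨅ n, 𝓟 (W n).1)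
  have : IsCountablyGenerated (@uniformity Z U) := hb.isCountablyGenerated
  obtain ⟨d, hd⟩ := @UniformSpace.metrizable_uniformity Z U this
  have hUV : V ∈ @uniformity Z U := mem_of_superset (hb.mem_of_mem (i := 0) trivial) hV₀V
  have hf := h d (hU.trans_eq hd.symm)
  rw [hd] at hf
  exact hf hUV

/-- Let `S` carry the finest uniformity for which all `plots` are uniformly continuous.  If `f`
is jointly uniformly continuous along every plot, then evaluating `f` along a uniformly continuous
map `p` from a connected metric space to `S` is uniformly continuous, although `p` need not be
a plot. -/
theorem uniformContinuous_eval_pseudoMetric {S : Type w} [US : UniformSpace S] {K Z : Type u}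
    [PseudoMetricSpace K] [PreconnectedSpace K] [PseudoMetricSpace Z]
    (Plot : ∀ M : UniformSpaceCat.{u}, (M → S) → Prop)
    (hS : ∀ U : UniformSpace S, (∀ M g, Plot M g → @UniformContinuous M S _ U g) → US ≤ U)
    (f : S → K → Z) (hc : ∀ x, UniformContinuous (f x))
    (hf : ∀ M g, Plot M g → UniformContinuous fun q : M × K => f (g q.1) q.2)
    (p : K → S) (hp : UniformContinuous p) : UniformContinuous fun k => f (p k) k := by
  -- The family `f · k` is uniformly equicontinuous on `S`.
  have h1 : ∀ ε > 0, ∃ δ > 0, ∀ k k', dist k k' < δ → ∀ l, dist (f (p k) l) (f (p k') l) < ε := by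
    intro ε hε
    have h : US ≤ UniformSpace.comap (fun x => UniformFun.ofFun (f x)) inferInstance := by
      refine hS _ fun M g hg => uniformContinuous_comap' ?_
      rw [UniformContinuous, (UniformFun.hasBasis_uniformity K Z).tendsto_right_iff]
      intro V hV
      have := hf M g hg hV
      rw [mem_map, uniformity_prod_eq_prod] at this
      obtain ⟨A, hA, B, hB, hAB⟩ := mem_prod_iff.1 (mem_map.1 this)
      filter_upwards [hA] with q hq l
      exact hAB (Set.mk_mem_prod (a := q) (b := (l, l)) hq (refl_mem_uniformity hB))
    have h2 : UniformContinuous fun k => UniformFun.ofFun (f (p k)) :=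
      (uniformContinuous_iff_le_comap.2 h).comp hp
    have h3 := h2 ((UniformFun.hasBasis_uniformity K Z).mem_of_mem (Metric.dist_mem_uniformity hε))
    obtain ⟨δ, hδ, h4⟩ := Metric.mem_uniformity_dist.1 h3
    exact ⟨δ, hδ, fun k k' hk l => h4 hk l⟩
  have h2 : ∀ ε > 0, ∃ δ > 0, ∀ k₀ k k', dist k k' < δ →
      dist (f (p k₀) k) (f (p k₀) k') < ε := by
    intro ε hε
    by_contra! hcon
    have hpos : ∀ n : ℕ, (0 : ℝ) < 1 / (n + 1) := fun n => Nat.one_div_pos_of_nat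
    choose x a b hab hx using fun n : ℕ => hcon _ (hpos n)
    let u : ℕ → S → ℝ := fun n s => max (dist (f s (a n)) (f s (b n)) - ε / 2) 0
    have hu0 : ∀ n s, dist (f s (a n)) (f s (b n)) < ε / 2 → u n s = 0 := fun n s h =>
      max_eq_right (by linarith)
    have hplot : ∀ M g, Plot M g → ∀ᶠ n in atTop, ∀ m, u n (g m) = 0 := by
      intro M g hg
      have := hf M g hg (Metric.dist_mem_uniformity (half_pos hε))
      rw [mem_map, uniformity_prod_eq_prod] at this
      obtain ⟨A, hA, B, hB, hAB⟩ := mem_prod_iff.1 (mem_map.1 this)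
      obtain ⟨δ, hδ, hB⟩ := Metric.mem_uniformity_dist.1 hB
      obtain ⟨N, hN⟩ := exists_nat_one_div_lt hδ
      filter_upwards [eventually_ge_atTop N] with n hn m
      refine hu0 n _ (hAB (Set.mk_mem_prod (a := (m, m)) (b := (a n, b n))
        (refl_mem_uniformity hA) (hB ((hab n).trans_le ((Nat.one_div_le_one_div hn).trans hN.le)))))
    have huniv : ∀ φ : ℕ → ℝ, ∃ δ > 0, ∀ k k', dist k k' < δ →
        ∀ n, dist (φ n * u n (p k)) (φ n * u n (p k')) < 1 := by
      intro φ
      have h : US ≤ UniformSpace.comap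
          (fun s => UniformFun.ofFun fun n => φ n * u n s) inferInstance := by
        refine hS _ fun M g hg => uniformContinuous_comap' ?_
        rw [UniformContinuous, (UniformFun.hasBasis_uniformity ℕ ℝ).tendsto_right_iff]
        intro V hV
        obtain ⟨N, hN⟩ := eventually_atTop.1 (hplot M g hg)
        have hn : ∀ n, UniformContinuous fun m => φ n * u n (g m) := by
          intro n
          have e : ∀ c : K, UniformContinuous fun m => f (g m) c := fun c =>
            (hf M g hg).comp (uniformContinuous_id.prodMk uniformContinuous_const)
          have e2 : UniformContinuous fun m => dist (f (g m) (a n)) (f (g m) (b n)) :=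
            (e _).dist (e _)
          have e3 : UniformContinuous fun t : ℝ => φ n * max (t - ε / 2) 0 := by
            have : LipschitzWith 1 fun t : ℝ => max (t - ε / 2) 0 :=
              LipschitzWith.max_const (LipschitzWith.of_dist_le_mul fun s t => by simp) 0
            exact Real.uniformContinuous_const_mul.comp this.uniformContinuous
          exact e3.comp e2
        have : ∀ᶠ q : M × M in 𝓤 M, ∀ n ∈ Finset.range N,
            (φ n * u n (g q.1), φ n * u n (g q.2)) ∈ V :=
          (Finset.eventually_all _).2 fun n _ => hn n hV
        filter_upwards [this] with q hq n
        by_cases hnN : n < N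
        · exact hq n (Finset.mem_range.2 hnN)
        · change (φ n * u n (g q.1), φ n * u n (g q.2)) ∈ V
          rw [hN n (not_lt.1 hnN), hN n (not_lt.1 hnN)]
          exact refl_mem_uniformity hV
      have h2 : UniformContinuous fun k => UniformFun.ofFun fun n => φ n * u n (p k) :=
        (uniformContinuous_iff_le_comap.2 h).comp hp
      have h3 := h2 ((UniformFun.hasBasis_uniformity ℕ ℝ).mem_of_mem
        (Metric.dist_mem_uniformity one_pos))
      obtain ⟨δ, hδ, h4⟩ := Metric.mem_uniformity_dist.1 h3
      exact ⟨δ, hδ, fun k k' hk n => h4 hk n⟩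
    -- By connectedness, a nonconstant function on `K` varies on arbitrarily close pairs.
    have hvar : ∃ N : ℕ, ∀ n : ℕ, n ≥ N → ∃ k k', dist k k' < 1 / ((n : ℝ) + 1) ∧ u n (p k) ≠ u n (p k') := by
      obtain ⟨δ, hδ, hδ'⟩ := Metric.uniformContinuous_iff.1 (hc (p (a 0))) _ (half_pos hε)
      obtain ⟨N, hN⟩ := exists_nat_one_div_lt hδ
      refine ⟨N, fun n hn => ?_⟩
      by_contra! hloc
      have hlc : IsLocallyConstant fun k => u n (p k) := by
        refine (IsLocallyConstant.iff_eventually_eq _).2 fun k => ?_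
        filter_upwards [Metric.ball_mem_nhds k (hpos n)] with k' hk'
        exact hloc k' k hk'
      have e1 : u n (p (a 0)) = 0 :=
        hu0 n _ (hδ' ((hab n).trans_le ((Nat.one_div_le_one_div hn).trans hN.le)))
      have e2 : u n (p (x n)) = 0 := (hlc.apply_eq_of_preconnectedSpace _ _).trans e1
      have e3 : dist (f (p (x n)) (a n)) (f (p (x n)) (b n)) - ε / 2 ≤ 0 :=
        (le_max_left _ _).trans e2.le
      linarith [hx n]
    obtain ⟨N, hN⟩ := hvar
    have : Nonempty K := ⟨a 0⟩
    choose! c c' hcc hne using hN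
    obtain ⟨δ, hδ, h⟩ := huniv fun n => |u n (p (c n)) - u n (p (c' n))|⁻¹
    obtain ⟨n₀, hn₀⟩ := exists_nat_one_div_lt hδ
    have hn := h (c (max N n₀)) (c' (max N n₀)) ((hcc _ (le_max_left _ _)).trans
      ((Nat.one_div_le_one_div (le_max_right N n₀)).trans_lt hn₀)) (max N n₀)
    have hne' := sub_ne_zero.2 (hne _ (le_max_left N n₀))
    rw [Real.dist_eq, ← mul_sub, abs_mul, abs_inv, abs_abs,
      inv_mul_cancel₀ (abs_ne_zero.2 hne')] at hn
    exact lt_irrefl _ hn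
  rw [Metric.uniformContinuous_iff]
  intro ε hε
  obtain ⟨δ₁, hδ₁, e1⟩ := h1 _ (half_pos hε)
  obtain ⟨δ₂, hδ₂, e2⟩ := h2 _ (half_pos hε)
  refine ⟨min δ₁ δ₂, lt_min hδ₁ hδ₂, fun k k' hk => ?_⟩
  have := dist_triangle (f (p k) k) (f (p k) k') (f (p k') k')
  linarith [e1 k k' (hk.trans_le (min_le_left _ _)) k', e2 k k k' (hk.trans_le (min_le_right _ _))]

theorem IsConnMetric.exists_eq_of {M : UniformSpaceCat.{u}} (hM : IsConnMetric M) :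
    ∃ (K : Type u) (_ : MetricSpace K) (_ : ConnectedSpace K) (_ : LocallyConnectedSpace K),
      M = UniformSpaceCat.of K := by
  obtain @⟨M, UM⟩ := M
  obtain ⟨h1, h2, d, hd⟩ := hM
  change ConnectedSpace M at h1
  change LocallyConnectedSpace M at h2
  change MetricSpace M at d
  change d.toPseudoMetricSpace.toUniformSpace = UM at hd
  subst hd
  exact ⟨M, d, h1, h2, rfl⟩

/-- Evaluation along a uniformly continuous map `p` from a connected metric space to the final
uniformity of a family of plots is uniformly continuous if it is so along each plot. -/
theorem uniformContinuous_eval {S : Type u} [US : UniformSpace S] {K : UniformSpaceCat.{u}}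
    (hK : IsConnMetric K) {Z : Type u} [UniformSpace Z]
    (Plot : ∀ M : UniformSpaceCat.{u}, (M → S) → Prop)
    (hS : ∀ U : UniformSpace S, (∀ M g, Plot M g → @UniformContinuous M S _ U g) → US ≤ U)
    (f : S → K → Z) (hc : ∀ x, UniformContinuous (f x))
    (hf : ∀ M g, Plot M g → UniformContinuous fun q : M × K => f (g q.1) q.2)
    (p : K → S) (hp : UniformContinuous p) : UniformContinuous fun k => f (p k) k := by
  obtain ⟨K, _, _, _, rfl⟩ := hK.exists_eq_of
  refine uniformContinuous_of_forall_pseudoMetric _ fun dZ hdZ => ?_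
  have hZ : @UniformContinuous Z Z _ dZ.toUniformSpace id := hdZ
  exact uniformContinuous_eval_pseudoMetric Plot hS f
    (fun x => @UniformContinuous.comp _ _ _ _ _ dZ.toUniformSpace id _ hZ (hc x))
    (fun M g hg => @UniformContinuous.comp _ _ _ _ _ dZ.toUniformSpace id _ hZ (hf M g hg)) p hp

end Evaluation

/-! ### Test spaces -/

theorem IsConnMetric.prod {M N : UniformSpaceCat.{u}} (hM : IsConnMetric M) (hN : IsConnMetric N) :
    IsConnMetric (UniformSpaceCat.of (M × N)) := by
  obtain ⟨M, _, _, _, rfl⟩ := hM.exists_eq_of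
  obtain ⟨N, _, _, _, rfl⟩ := hN.exists_eq_of
  exact ⟨inferInstanceAs (ConnectedSpace (M × N)), inferInstanceAs (LocallyConnectedSpace (M × N)),
    inferInstanceAs (MetricSpace (M × N)), rfl⟩

theorem isConnMetric_ulift (K : Type) [MetricSpace K] [ConnectedSpace K]
    [LocallyConnectedSpace K] : IsConnMetric (UniformSpaceCat.of (ULift.{u} K)) :=
  ⟨Function.Surjective.connectedSpace (f := ULift.up) ULift.up_surjective continuous_uliftUp,
    (Homeomorph.ulift.{u} (X := K)).locallyConnectedSpace,
    inferInstanceAs (MetricSpace (ULift K)), rfl⟩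

instance : LocallyConnectedSpace I :=
  (isQuotientMap_projIcc (h := zero_le_one (α := ℝ))).isCoinducing.locallyConnectedSpace

/-! ### Objects and morphisms of `Unif` -/

theorem IsConnMetric.t0Space {M : UniformSpaceCat.{u}} (hM : IsConnMetric M) : T0Space M := by
  obtain ⟨M, _, _, _, rfl⟩ := hM.exists_eq_of
  exact inferInstanceAs (T0Space M)

instance (X : Unif.{u}) : T0Space X.obj := X.property.1

/-- An object of `Unif` carries the final uniformity for all uniformly continuous maps to it from
test spaces. -/
theorem Unif.uniformContinuous_of_test {X : Unif.{u}} {Z : Type w} [UniformSpace Z]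
    (f : X.obj → Z) (h : ∀ (M : UniformSpaceCat.{u}) (g : M → X.obj), IsConnMetric M →
      UniformContinuous g → UniformContinuous (f ∘ g)) : UniformContinuous f := by
  obtain ⟨-, J, _, F, ι, hF, ⟨hι⟩⟩ := X.property
  let s : Cocone F := Cocone.mk (UniformSpaceCat.of (Corefl X.obj))
    { app := fun j => UniformSpaceCat.ofHom (X := F.obj j) (Y := Corefl X.obj) ⟨ι.app j,
        Corefl.uniformContinuous_test X.obj _ _ (hF j) (ι.app j).hom.2⟩
      naturality := fun i j φ => UniformSpaceCat.hom_ext (funext fun x =>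
        ConcreteCategory.congr_hom (ι.naturality φ) x) }
  have hd : hι.desc s ≫ UniformSpaceCat.ofHom (X := Corefl X.obj) (Y := X.obj)
      ⟨_, Corefl.uniformContinuous_id X.obj⟩ = 𝟙 X.obj :=
    hι.hom_ext fun j => by
      rw [hι.fac_assoc s j]
      rfl
  have hid : (hι.desc s : X.obj → Corefl X.obj) = fun x => x :=
    funext fun x => ConcreteCategory.congr_hom hd x
  have huc : @UniformContinuous X.obj (Corefl X.obj) _ _ fun x => x := by
    rw [← hid]
    exact (hι.desc s).hom.2
  exact (Corefl.uniformContinuous_of_test X.obj f h).comp huc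

theorem unifProp_of_uniformContinuous_corefl (X : UniformSpaceCat.{u}) (h0 : T0Space X)
    (h : @UniformContinuous X (Corefl X) _ _ fun x => x) : unifProp X := by
  obtain @⟨X, UX⟩ := X
  have e : UX = (inferInstanceAs (UniformSpace (Corefl X)) : UniformSpace X) :=
    le_antisymm h (Corefl.uniformContinuous_id X)
  have h1 : UniformSpaceCat.of X = UniformSpaceCat.of (Corefl X) :=
    congrArg (@UniformSpaceCat.of X) e
  have : T0Space X := h0
  exact h1 ▸ unifProp_corefl X

/-- A connected, locally connected metric space, as an object of `Unif`. -/
def Unif.ofTest (M : UniformSpaceCat.{u}) (hM : IsConnMetric M) : Unif.{u} :=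
  ⟨M, unifProp_of_uniformContinuous_corefl M hM.t0Space
    (Corefl.uniformContinuous_test M M _ hM uniformContinuous_id)⟩

/-- The morphism of `Unif` given by a uniformly continuous map. -/
def Unif.mkHom {X Y : Unif.{u}} (f : X.obj → Y.obj) (hf : UniformContinuous f) : X ⟶ Y :=
  ObjectProperty.homMk ⟨⟨f, hf⟩⟩

theorem Unif.uniformContinuous_toMap {X Y : Unif.{u}} (f : X ⟶ Y) :
    UniformContinuous (Unif.toMap f) := f.hom.hom.2

@[simp]
theorem Unif.toMap_mkHom {X Y : Unif.{u}} (f : X.obj → Y.obj) (hf : UniformContinuous f)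
    (x : X.obj) : Unif.toMap (Unif.mkHom f hf) x = f x := rfl

@[simp]
theorem Unif.toMap_comp {X Y Z : Unif.{u}} (f : X ⟶ Y) (g : Y ⟶ Z) (x : X.obj) :
    Unif.toMap (f ≫ g) x = Unif.toMap g (Unif.toMap f x) := rfl

@[simp]
theorem Unif.toMap_id (X : Unif.{u}) (x : X.obj) : Unif.toMap (𝟙 X) x = x := rfl

theorem Unif.hom_ext {X Y : Unif.{u}} {f g : X ⟶ Y} (h : ∀ x, Unif.toMap f x = Unif.toMap g x) :
    f = g :=
  ObjectProperty.hom_ext _ (UniformSpaceCat.hom_ext (funext h))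

theorem Unif.toMap_congr {X Y : Unif.{u}} {f g : X ⟶ Y} (h : f = g) (x : X.obj) :
    Unif.toMap f x = Unif.toMap g x := by rw [h]

/-- Uniformly continuous maps from an object of `Unif` are uniformly continuous for the
coreflected uniformity of the target. -/
theorem Unif.uniformContinuous_corefl {B : Unif.{u}} {S : Type u} [UniformSpace S]
    {f : B.obj → S} (hf : UniformContinuous f) : @UniformContinuous B.obj (Corefl S) _ _ f :=
  Unif.uniformContinuous_of_test (Z := Corefl S) f fun M _ hM hg =>
    Corefl.uniformContinuous_test S M _ hM (hf.comp hg)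

/-! ### Finite limits -/

/-- The one-point object. -/
def Unif.pt : Unif.{u} := Unif.ofTest _ isConnMetric_punit

/-- The one-point object is terminal. -/
def Unif.ptIsTerminal : IsTerminal Unif.pt.{u} :=
  IsTerminal.ofUniqueHom (fun _ => Unif.mkHom (Y := Unif.pt) (fun _ => PUnit.unit)
    uniformContinuous_const) fun _ _ => Unif.hom_ext fun _ => rfl

section Pullback

variable {X Y Z : Unif.{u}} (f : X ⟶ Z) (g : Y ⟶ Z)

/-- The pullback in `Unif`: the coreflection of the set-theoretic fibre product. -/
def Unif.pullbackObj : Unif.{u} :=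
  Unif.corefl { q : X.obj × Y.obj // Unif.toMap f q.1 = Unif.toMap g q.2 }

/-- The first projection from the pullback. -/
def Unif.pullbackFst : Unif.pullbackObj f g ⟶ X :=
  Unif.mkHom (fun q : { q : X.obj × Y.obj // Unif.toMap f q.1 = Unif.toMap g q.2 } => q.1.1)
    ((uniformContinuous_fst.comp uniformContinuous_subtype_val).comp
      (Corefl.uniformContinuous_id _))

/-- The second projection from the pullback. -/
def Unif.pullbackSnd : Unif.pullbackObj f g ⟶ Y :=
  Unif.mkHom (fun q : { q : X.obj × Y.obj // Unif.toMap f q.1 = Unif.toMap g q.2 } => q.1.2)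
    ((uniformContinuous_snd.comp uniformContinuous_subtype_val).comp
      (Corefl.uniformContinuous_id _))

theorem Unif.isPullback : IsPullback (Unif.pullbackFst f g) (Unif.pullbackSnd f g) f g := by
  refine ⟨⟨Unif.hom_ext fun q => q.2⟩, ⟨PullbackCone.IsLimit.mk _ (fun s => Unif.mkHom
    (fun x => (⟨(Unif.toMap s.fst x, Unif.toMap s.snd x), Unif.toMap_congr s.condition x⟩ :
      { q : X.obj × Y.obj // Unif.toMap f q.1 = Unif.toMap g q.2 }))
    (Unif.uniformContinuous_corefl (((Unif.uniformContinuous_toMap _).prodMk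
      (Unif.uniformContinuous_toMap _)).subtype_mk _))) (fun _ => rfl) (fun _ => rfl) ?_⟩⟩
  intro s m h1 h2
  exact Unif.hom_ext fun x => Subtype.ext (Prod.ext (Unif.toMap_congr h1 x) (Unif.toMap_congr h2 x))

end Pullback

theorem Unif.hasFiniteLimits : HasFiniteLimits Unif.{u} := by
  have : HasTerminal Unif.{u} := Unif.ptIsTerminal.hasTerminal
  have (X Y Z : Unif.{u}) (f : X ⟶ Z) (g : Y ⟶ Z) : HasLimit (cospan f g) :=
    (Unif.isPullback f g).hasPullback
  have : HasPullbacks Unif.{u} := hasPullbacks_of_hasLimit_cospan _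
  exact hasFiniteLimits_of_hasTerminal_and_pullbacks

/-! ### Cartesian closedness -/

/-- The product in `Unif`: the coreflection of the product of uniform spaces. -/
def Unif.prodObj (A B : Unif.{u}) : Unif.{u} := Unif.corefl (A.obj × B.obj)

/-- The first projection from the product. -/
def Unif.prodFst (A B : Unif.{u}) : Unif.prodObj A B ⟶ A :=
  Unif.mkHom (fun q : A.obj × B.obj => q.1)
    (uniformContinuous_fst.comp (Corefl.uniformContinuous_id _))

/-- The second projection from the product. -/
def Unif.prodSnd (A B : Unif.{u}) : Unif.prodObj A B ⟶ B :=
  Unif.mkHom (fun q : A.obj × B.obj => q.2)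
    (uniformContinuous_snd.comp (Corefl.uniformContinuous_id _))

/-- The product cone is a limit. -/
def Unif.prodIsLimit (A B : Unif.{u}) :
    IsLimit (BinaryFan.mk (Unif.prodFst A B) (Unif.prodSnd A B)) :=
  BinaryFan.isLimitMk (fun s => Unif.mkHom
    (fun x => ((Unif.toMap s.fst x, Unif.toMap s.snd x) : A.obj × B.obj))
    (Unif.uniformContinuous_corefl ((Unif.uniformContinuous_toMap _).prodMk
      (Unif.uniformContinuous_toMap _)))) (fun _ => rfl) (fun _ => rfl)
    fun _ _ h1 h2 => Unif.hom_ext fun x => Prod.ext (Unif.toMap_congr h1 x) (Unif.toMap_congr h2 x)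

/-- The Cartesian monoidal structure on `Unif`. -/
@[reducible]
def Unif.cartesianMonoidalCategory : CartesianMonoidalCategory Unif.{u} :=
  .ofChosenFiniteProducts ⟨_, Unif.ptIsTerminal⟩ fun A B => ⟨_, Unif.prodIsLimit A B⟩

section Exponential

variable (A X : Unif.{u})

/-- The set of morphisms `A ⟶ X`. -/
def HomSpace : Type u := { f : A.obj → X.obj // UniformContinuous f }

/-- The plots of the exponential: the families of morphisms parametrized by a test space `M` that
are uniformly continuous as maps from the product of `M` and `A` in `Unif`. -/
def HomSpace.Plot (M : UniformSpaceCat.{u}) (g : M → HomSpace A X) : Prop :=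
  IsConnMetric M ∧ ∀ (N : UniformSpaceCat.{u}), IsConnMetric N → ∀ (m : N → M) (a : N → A.obj),
    UniformContinuous m → UniformContinuous a → UniformContinuous fun k => (g (m k)).1 (a k)

/-- The final uniformity for the plots. -/
instance : UniformSpace (HomSpace A X) :=
  sInf { U | ∀ M g, HomSpace.Plot A X M g → @UniformContinuous M _ _ U g }

variable {A X}

theorem HomSpace.le_of_plot (U : UniformSpace (HomSpace A X))
    (h : ∀ M g, HomSpace.Plot A X M g → @UniformContinuous M _ _ U g) :
    instUniformSpaceHomSpace A X ≤ U :=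
  sInf_le (α := UniformSpace (HomSpace A X)) h

theorem HomSpace.Plot.uniformContinuous {M : UniformSpaceCat.{u}} {g : M → HomSpace A X}
    (h : HomSpace.Plot A X M g) : UniformContinuous g :=
  uniformContinuous_sInf_rng.2 fun _ hU => hU M g h

theorem HomSpace.uniformContinuous_eval {K : UniformSpaceCat.{u}} (hK : IsConnMetric K)
    {p : K → HomSpace A X} (hp : UniformContinuous p) {a : K → A.obj} (ha : UniformContinuous a) :
    UniformContinuous fun k => (p k).1 (a k) := by
  refine UniformHomotopy.uniformContinuous_eval hK (HomSpace.Plot A X) HomSpace.le_of_plot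
    (fun x k => x.1 (a k)) (fun x => x.2.comp ha) (fun M g hg => ?_) p hp
  exact hg.2 (UniformSpaceCat.of (M × K)) (hg.1.prod hK) Prod.fst (fun q => a q.2)
    uniformContinuous_fst (ha.comp uniformContinuous_snd)

theorem HomSpace.uniformContinuous_apply (a : A.obj) :
    UniformContinuous fun φ : HomSpace A X => φ.1 a :=
  uniformContinuous_iff_le_comap.2 <| HomSpace.le_of_plot _ fun M g hg =>
    uniformContinuous_comap' (g := g) (f := fun φ : HomSpace A X => φ.1 a) <| hg.2 M hg.1 id (fun _ => a) uniformContinuous_id uniformContinuous_const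

instance : T0Space (HomSpace A X) := by
  have : Function.Injective fun (φ : HomSpace A X) (a : A.obj) => φ.1 a :=
    fun φ ψ h => Subtype.ext h
  exact t0Space_of_injective_of_continuous this
    (continuous_pi fun a => (HomSpace.uniformContinuous_apply a).continuous)

variable (A X) in
/-- The exponential object. -/
def Unif.exp : Unif.{u} := Unif.corefl (HomSpace A X)

/-- Morphisms from a product correspond to morphisms to the exponential. -/
def Unif.expEquiv (A B X : Unif.{u}) : (Unif.prodObj A B ⟶ X) ≃ (B ⟶ Unif.exp A X) where
  toFun f := Unif.mkHom (fun b => (⟨fun a => Unif.toMap f (a, b),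
      (Unif.uniformContinuous_toMap f).comp (Unif.uniformContinuous_corefl
        (uniformContinuous_id.prodMk uniformContinuous_const))⟩ : HomSpace A X)) <| by
    refine Unif.uniformContinuous_corefl (S := HomSpace A X) ?_
    refine Unif.uniformContinuous_of_test _ fun M g hM hg => ?_
    refine HomSpace.Plot.uniformContinuous ⟨hM, fun N hN m a hm ha => ?_⟩
    exact (Unif.uniformContinuous_toMap f).comp
      (Corefl.uniformContinuous_test _ N _ hN (ha.prodMk (hg.comp hm)))
  invFun h := Unif.mkHom (X := Unif.prodObj A B)
      (fun q : A.obj × B.obj => (show HomSpace A X from Unif.toMap h q.2).1 q.1) <| by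
    refine Corefl.uniformContinuous_of_test _ _ fun M g hM hg => ?_
    exact HomSpace.uniformContinuous_eval hM (p := fun k => Unif.toMap h (g k).2)
      ((Corefl.uniformContinuous_id _).comp
        ((Unif.uniformContinuous_toMap h).comp (uniformContinuous_snd.comp hg)))
      (uniformContinuous_fst.comp hg)
  left_inv _ := rfl
  right_inv _ := rfl

end Exponential

theorem Unif.exists_cartesianClosed :
    ∃ _ : CartesianMonoidalCategory Unif.{u}, Nonempty (MonoidalClosed Unif.{u}) := by
  let := Unif.cartesianMonoidalCategory.{u}
  exact ⟨Unif.cartesianMonoidalCategory, ⟨{ closed := fun A =>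
    { rightAdj := Adjunction.rightAdjointOfEquiv (F := MonoidalCategory.tensorLeft A)
        (G_obj := Unif.exp A) (Unif.expEquiv A) fun _ _ _ _ _ => rfl
      adj := Adjunction.adjunctionOfEquivRight _ _ } }⟩⟩

/-! ### Exponential objects through evaluation -/

/-- A map of two variables is jointly uniformly continuous along test spaces; for objects `K`
and `B` of `Unif` this says that it is a morphism from their product in `Unif`. -/
def JointUC {K : Type w} [UniformSpace K] {B Z : Unif.{u}} (H : K → B.obj → Z.obj) : Prop :=
  ∀ N : UniformSpaceCat.{u}, IsConnMetric N → ∀ (t : N → K) (b : N → B.obj),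
    UniformContinuous t → UniformContinuous b → UniformContinuous fun k => H (t k) (b k)

/-- A compact connected, locally connected metric space as an object of `Unif`. -/
def Unif.ofCompact (K : Type) [MetricSpace K] [ConnectedSpace K] [LocallyConnectedSpace K] :
    Unif.{u} :=
  Unif.ofTest _ (isConnMetric_ulift K)

theorem uniformContinuous_uliftDown {K : Type v} [UniformSpace K] :
    UniformContinuous (ULift.down : ULift.{u} K → K) := uniformContinuous_comap

theorem uniformContinuous_uliftUp {K : Type v} [UniformSpace K] :
    UniformContinuous (ULift.up : K → ULift.{u} K) := uniformContinuous_comap' uniformContinuous_id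

theorem JointUC.apply {K : Type w} [UniformSpace K] {B Z : Unif.{u}} {H : K → B.obj → Z.obj}
    (h : JointUC H) (k : K) : UniformContinuous (H k) :=
  Unif.uniformContinuous_of_test _ fun M g hM hg => h M hM (fun _ => k) g uniformContinuous_const hg

/-- The point `x` as a morphism. -/
def Unif.const {X : Unif.{u}} (x : X.obj) : Unif.pt ⟶ X :=
  Unif.mkHom (fun _ => x) uniformContinuous_const

section Generic

open MonoidalCategory CartesianMonoidalCategory MonoidalClosed

variable [CartesianMonoidalCategory Unif.{u}]

/-- The point of a product with the given coordinates. -/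
def Unif.pair {A B : Unif.{u}} (a : A.obj) (b : B.obj) : (A ⊗ B).obj :=
  Unif.toMap (lift (Unif.const a) (Unif.const b)) PUnit.unit

theorem Unif.toMap_lift {A B W : Unif.{u}} (f : W ⟶ A) (g : W ⟶ B) (x : W.obj) :
    Unif.toMap (lift f g) x = Unif.pair (Unif.toMap f x) (Unif.toMap g x) := by
  have : Unif.const x ≫ lift f g =
      lift (Unif.const (Unif.toMap f x)) (Unif.const (Unif.toMap g x)) := by
    rw [comp_lift]
    rfl
  exact Unif.toMap_congr this PUnit.unit

@[simp]
theorem Unif.fst_pair {A B : Unif.{u}} (a : A.obj) (b : B.obj) :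
    Unif.toMap (fst A B) (Unif.pair a b) = a :=
  Unif.toMap_congr (lift_fst (Unif.const a) (Unif.const b)) PUnit.unit

@[simp]
theorem Unif.snd_pair {A B : Unif.{u}} (a : A.obj) (b : B.obj) :
    Unif.toMap (snd A B) (Unif.pair a b) = b :=
  Unif.toMap_congr (lift_snd (Unif.const a) (Unif.const b)) PUnit.unit

theorem Unif.pair_eta {A B : Unif.{u}} (z : (A ⊗ B).obj) :
    Unif.pair (Unif.toMap (fst A B) z) (Unif.toMap (snd A B) z) = z := by
  rw [← Unif.toMap_lift, lift_fst_snd]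
  rfl

theorem Unif.uniformContinuous_pair {A B W : Unif.{u}} {a : W.obj → A.obj} {b : W.obj → B.obj}
    (ha : UniformContinuous a) (hb : UniformContinuous b) :
    UniformContinuous fun k => (Unif.pair (a k) (b k) : (A ⊗ B).obj) := by
  have := Unif.uniformContinuous_toMap (lift (Unif.mkHom a ha) (Unif.mkHom b hb))
  convert this using 2 with k
  exact (Unif.toMap_lift (Unif.mkHom a ha) (Unif.mkHom b hb) k).symm

theorem Unif.whiskerLeft_pair {A B C : Unif.{u}} (g : B ⟶ C) (a : A.obj) (b : B.obj) :
    Unif.toMap (A ◁ g) (Unif.pair a b) = Unif.pair a (Unif.toMap g b) := by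
  have h1 := Unif.toMap_congr (whiskerLeft_fst A g) (Unif.pair a b)
  have h2 := Unif.toMap_congr (whiskerLeft_snd A g) (Unif.pair a b)
  rw [← Unif.pair_eta (Unif.toMap (A ◁ g) (Unif.pair a b))]
  simp only [Unif.toMap_comp, Unif.fst_pair, Unif.snd_pair] at h1 h2
  rw [h1, h2]

variable [MonoidalClosed Unif.{u}] {A B X Y : Unif.{u}}

/-- The evaluation of a point of the exponential object. -/
def Unif.ev (φ : ((ihom A).obj X).obj) (a : A.obj) : X.obj :=
  Unif.toMap ((ihom.ev A).app X) (Unif.pair a φ)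

theorem Unif.toMap_uncurry (g : B ⟶ (ihom A).obj X) (a : A.obj) (b : B.obj) :
    Unif.toMap (uncurry g) (Unif.pair a b) = Unif.ev (Unif.toMap g b) a := by
  rw [uncurry_eq, Unif.toMap_comp, Unif.whiskerLeft_pair]
  rfl

theorem Unif.ev_ext {φ ψ : ((ihom A).obj X).obj} (h : ∀ a, Unif.ev φ a = Unif.ev ψ a) :
    φ = ψ := by
  have : Unif.const φ = Unif.const ψ := by
    refine uncurry_injective (Unif.hom_ext fun z => ?_)
    rw [← Unif.pair_eta z, Unif.toMap_uncurry, Unif.toMap_uncurry]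
    exact h _
  exact Unif.toMap_congr this PUnit.unit

@[simp]
theorem Unif.ev_homMap (f : X ⟶ Y) (φ : ((ihom A).obj X).obj) (a : A.obj) :
    Unif.ev (homMap A f φ) a = Unif.toMap f (Unif.ev φ a) := by
  have := Unif.toMap_congr (ihom.ev_naturality A f) (Unif.pair a φ)
  rw [Unif.toMap_comp, Unif.whiskerLeft_pair] at this
  exact this

theorem Unif.uniformContinuous_ev {N : UniformSpaceCat.{u}} (hN : IsConnMetric N)
    {φ : N → ((ihom A).obj X).obj} {a : N → A.obj} (hφ : UniformContinuous φ)
    (ha : UniformContinuous a) : UniformContinuous fun k => Unif.ev (φ k) (a k) :=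
  (Unif.uniformContinuous_toMap _).comp
    (Unif.uniformContinuous_pair (W := Unif.ofTest N hN) ha hφ)

/-- The morphism to an exponential object given by a jointly uniformly continuous map. -/
def Unif.expMk (θ : B.obj → A.obj → X.obj) (hθ : JointUC θ) : B ⟶ (ihom A).obj X :=
  curry (Unif.mkHom (fun z => θ (Unif.toMap (snd A B) z) (Unif.toMap (fst A B) z))
    (Unif.uniformContinuous_of_test _ fun M _ hM hg => hθ M hM _ _
      ((Unif.uniformContinuous_toMap _).comp hg) ((Unif.uniformContinuous_toMap _).comp hg)))

@[simp]
theorem Unif.ev_expMk (θ : B.obj → A.obj → X.obj) (hθ : JointUC θ) (b : B.obj) (a : A.obj) :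
    Unif.ev (Unif.toMap (Unif.expMk θ hθ) b) a = θ b a := by
  rw [← Unif.toMap_uncurry, Unif.expMk, uncurry_curry, Unif.toMap_mkHom, Unif.fst_pair,
    Unif.snd_pair]

/-- Every uniformly continuous map is a point of the exponential object. -/
theorem Unif.exists_ev_eq (θ : A.obj → X.obj) (hθ : UniformContinuous θ) :
    ∃ φ : ((ihom A).obj X).obj, ∀ a, Unif.ev φ a = θ a :=
  ⟨Unif.toMap (Unif.expMk (B := Unif.pt) (fun _ => θ) fun _ _ _ _ _ ha => hθ.comp ha)
    PUnit.unit, fun a => Unif.ev_expMk _ _ _ a⟩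

theorem Unif.uniformContinuous_exp_iff {F : B.obj → ((ihom A).obj X).obj} :
    UniformContinuous F ↔ JointUC fun b a => Unif.ev (F b) a := by
  refine ⟨fun h N hN t a ht ha => Unif.uniformContinuous_ev hN (h.comp ht) ha, fun h => ?_⟩
  have : F = Unif.toMap (Unif.expMk _ h) := funext fun b => Unif.ev_ext fun a => by simp
  rw [this]
  exact Unif.uniformContinuous_toMap _

section Compact

variable {K : Type} [MetricSpace K] [CompactSpace K] [ConnectedSpace K] [LocallyConnectedSpace K]

theorem Unif.continuous_exp_iff {F : K → ((ihom A).obj X).obj} :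
    Continuous F ↔ JointUC fun k a => Unif.ev (F k) a := by
  constructor
  · intro h N hN t a ht ha
    exact Unif.uniformContinuous_ev hN
      ((CompactSpace.uniformContinuous_of_continuous h).comp ht) ha
  · intro h
    have : UniformContinuous fun k : ULift.{u} K => F k.down := by
      refine (Unif.uniformContinuous_exp_iff (B := Unif.ofCompact K)).2 fun N hN t a ht ha => ?_
      exact h N hN (fun k => (t k).down) a (uniformContinuous_uliftDown.comp ht) ha
    exact this.continuous.comp continuous_uliftUp

/-- Families of points of an exponential object with compact parameter space `K`. -/
theorem Unif.exists_continuousMap_exp {θ : K → A.obj → X.obj} (hθ : JointUC θ) :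
    ∃ F : C(K, ((ihom A).obj X).obj), ∀ k a, Unif.ev (F k) a = θ k a := by
  choose F hF using fun k => Unif.exists_ev_eq (θ k) (hθ.apply k)
  refine ⟨⟨F, Unif.continuous_exp_iff.2 ?_⟩, hF⟩
  simpa only [hF] using hθ

/-- Maps to `(X ^ A) ^ B` as maps to `X ^ (A ⊗ B)`, with a compact space of parameters. -/
theorem Unif.exists_curry {H : K → B.obj → ((ihom A).obj X).obj} (hH : JointUC H) :
    ∃ θ : C(K, ((ihom (A ⊗ B)).obj X).obj), ∀ k a b,
      Unif.ev (θ k) (Unif.pair a b) = Unif.ev (H k b) a := by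
  obtain ⟨θ, hθ⟩ := Unif.exists_continuousMap_exp (A := A ⊗ B) (θ := fun k z =>
    Unif.ev (H k (Unif.toMap (snd A B) z)) (Unif.toMap (fst A B) z)) fun N hN t z ht hz =>
      Unif.uniformContinuous_ev hN
        (hH N hN _ _ ht ((Unif.uniformContinuous_toMap _).comp hz))
        ((Unif.uniformContinuous_toMap _).comp hz)
  exact ⟨θ, fun k a b => by rw [hθ, Unif.fst_pair, Unif.snd_pair]⟩

/-- Maps to `X ^ (A ⊗ B)` as maps to `(X ^ A) ^ B`, with a compact space of parameters. -/
theorem Unif.exists_uncurry (θ : C(K, ((ihom (A ⊗ B)).obj X).obj)) :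
    ∃ H : K → B.obj → ((ihom A).obj X).obj, JointUC H ∧ ∀ k a b,
      Unif.ev (H k b) a = Unif.ev (θ k) (Unif.pair a b) := by
  have hθ := Unif.continuous_exp_iff.1 θ.continuous
  choose H hH using fun k b => Unif.exists_ev_eq (A := A) (X := X)
    (fun a => Unif.ev (θ k) (Unif.pair a b)) <|
      (hθ.apply k).comp (Unif.uniformContinuous_pair (W := A) uniformContinuous_id
        uniformContinuous_const)
  refine ⟨H, fun N hN t b ht hb => ?_, fun k a b => hH k b a⟩
  refine (Unif.uniformContinuous_exp_iff (B := Unif.ofTest N hN)).2 fun M hM m a hm ha => ?_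
  simp only [hH]
  exact hθ M hM _ _ (ht.comp hm)
    (Unif.uniformContinuous_pair (W := Unif.ofTest M hM) ha (hb.comp hm))

theorem Unif.jointUC_ofCompact_iff {Z : Unif.{u}} {K' : Type} [MetricSpace K'] [CompactSpace K']
    [ConnectedSpace K'] [LocallyConnectedSpace K']
    {H : K → (Unif.ofCompact K').obj → ((ihom A).obj Z).obj} :
    JointUC H ↔ Continuous fun q : K × K' => H q.1 (ULift.up q.2) := by
  constructor
  · intro h
    rw [Unif.continuous_exp_iff]
    intro N hN t a ht ha
    exact Unif.uniformContinuous_ev hN (h N hN (fun k => (t k).1) (fun k => ULift.up (t k).2)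
      (uniformContinuous_fst.comp ht)
      (uniformContinuous_uliftUp.comp (uniformContinuous_snd.comp ht))) ha
  · intro h N hN t b ht hb
    exact (CompactSpace.uniformContinuous_of_continuous h).comp
      (ht.prodMk (uniformContinuous_uliftDown.comp hb))

end Compact

end Generic

/-! ### Piecewise linear extensions of maps of cubes -/

theorem tensorMap_monotone {m n m' n' : ℕ} {f : (Fin m → Bool) → (Fin n → Bool)}
    {g : (Fin m' → Bool) → (Fin n' → Bool)} (hf : Monotone f) (hg : Monotone g) :
    Monotone (tensorMap f g) := by
  intro x y h j
  refine Fin.addCases (fun i => ?_) (fun i => ?_) j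
  · simpa [tensorMap] using hf (fun i => h (Fin.castAdd m' i)) i
  · simpa [tensorMap] using hg (fun i => h (Fin.natAdd m i)) i

theorem IsCubeMap.monotone {m n : ℕ} {φ : (Fin m → Bool) → (Fin n → Bool)} (h : IsCubeMap φ) :
    Monotone φ := by
  induction h with
  | id n => exact monotone_id
  | comp _ _ hf hg => exact hg.comp hf
  | tensor _ _ hf hg => exact tensorMap_monotone hf hg
  | face b => exact monotone_const
  | degeneracy => exact fun _ _ _ i => i.elim0
  | connection => exact fun x y h _ => sup_le_sup (h 0) (h 1)

/-- The vertex of the cube recording which coordinates of `x` are at least `t`. -/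
noncomputable def threshold {m : ℕ} (t : I) (x : Fin m → I) : Fin m → Bool :=
  fun i => decide (t ≤ x i)

/-- The extension of a monotone map of cubes is determined by its compatibility with
thresholds. -/
theorem le_cubeExt_iff {m n : ℕ} {φ : (Fin m → Bool) → (Fin n → Bool)} (hφ : Monotone φ) {t : I}
    (ht : 0 < t) (x : Fin m → I) (j : Fin n) :
    t ≤ cubeExt φ x j ↔ φ (threshold t x) j = true := by
  rw [cubeExt, Finset.le_sup_iff (show ⊥ < t from ht)]
  simp only [Finset.mem_filter, Finset.mem_univ, true_and, Finset.le_inf_iff]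
  constructor
  · rintro ⟨v, hv, h⟩
    have hle : v ≤ threshold t x := fun i => by
      cases hvi : v i
      · exact Bool.false_le _
      · exact (decide_eq_true (h i hvi)).ge
    exact hφ hle j hv
  · exact fun h => ⟨_, h, fun i hi => by simpa [threshold] using hi⟩

theorem unitInterval_eq_of_forall_le_iff {a b : I} (h : ∀ t : I, 0 < t → (t ≤ a ↔ t ≤ b)) :
    a = b := by
  have key : ∀ {a b : I}, (∀ t : I, 0 < t → (t ≤ a ↔ t ≤ b)) → a ≤ b := fun {a b} h => by
    rcases eq_or_lt_of_le (unitInterval.nonneg' : 0 ≤ a) with h0 | h0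
    · exact h0 ▸ unitInterval.nonneg'
    · exact (h a h0).1 le_rfl
  exact le_antisymm (key h) (key fun t ht => (h t ht).symm)

theorem threshold_cubeExt {m n : ℕ} {φ : (Fin m → Bool) → (Fin n → Bool)} (hφ : Monotone φ) {t : I}
    (ht : 0 < t) (x : Fin m → I) : threshold t (cubeExt φ x) = φ (threshold t x) := by
  funext j
  rw [Bool.eq_iff_iff, ← le_cubeExt_iff hφ ht, threshold, decide_eq_true_eq]

theorem cubeExt_comp {l m n : ℕ} {φ : (Fin l → Bool) → (Fin m → Bool)}
    {ψ : (Fin m → Bool) → (Fin n → Bool)} (hφ : Monotone φ) (hψ : Monotone ψ) (x : Fin l → I) :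
    cubeExt (fun v => ψ (φ v)) x = cubeExt ψ (cubeExt φ x) :=
  funext fun j => unitInterval_eq_of_forall_le_iff fun t ht => by
    rw [le_cubeExt_iff (φ := fun v => ψ (φ v)) (hψ.comp hφ) ht, le_cubeExt_iff hψ ht, threshold_cubeExt hφ ht]

theorem cubeExt_id {n : ℕ} (x : Fin n → I) : cubeExt (fun v : Fin n → Bool => v) x = x :=
  funext fun j => unitInterval_eq_of_forall_le_iff fun t ht => by
    rw [le_cubeExt_iff (φ := fun v => v) monotone_id ht, threshold, decide_eq_true_eq]

theorem cubeExt_tensorMap {m n m' n' : ℕ} {f : (Fin m → Bool) → (Fin n → Bool)}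
    {g : (Fin m' → Bool) → (Fin n' → Bool)} (hf : Monotone f) (hg : Monotone g)
    (x : Fin (m + m') → I) : cubeExt (tensorMap f g) x =
      Fin.append (cubeExt f fun i => x (Fin.castAdd m' i))
        (cubeExt g fun i => x (Fin.natAdd m i)) := by
  refine funext fun j => unitInterval_eq_of_forall_le_iff fun t ht => ?_
  rw [le_cubeExt_iff (tensorMap_monotone hf hg) ht]
  refine Fin.addCases (fun i => ?_) (fun i => ?_) j
  · rw [Fin.append_left, le_cubeExt_iff hf ht, tensorMap, Fin.append_left]
    rfl
  · rw [Fin.append_right, le_cubeExt_iff hg ht, tensorMap, Fin.append_right]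
    rfl

theorem cubeExt_face (b : Bool) (x : Fin 0 → I) :
    cubeExt (fun (_ : Fin 0 → Bool) (_ : Fin 1) => b) x = fun _ => if b then 1 else 0 := by
  refine funext fun j => unitInterval_eq_of_forall_le_iff fun t ht => ?_
  rw [le_cubeExt_iff monotone_const ht]
  cases b
  · simpa using ht.ne'
  · simpa using unitInterval.le_one'

theorem continuous_cubeExt {m n : ℕ} (φ : (Fin m → Bool) → (Fin n → Bool)) :
    Continuous (cubeExt φ) :=
  continuous_pi fun _ => Continuous.finset_sup_apply fun _ _ =>
    Continuous.finset_inf_apply fun i _ => continuous_apply i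

/-! ### Topological realization -/

section Realization

variable {D : CubicalSet.{u}} {Z : Type v} [TopologicalSpace Z]

/-- The point of the realization with coordinates `x` in the cube `c`. -/
def cubePt {n : ℕ} (c : D.obj (op ⟨n⟩)) (x : Fin n → I) : TopRealization D :=
  Quot.mk _ ⟨n, c, x⟩

theorem cubePt_map {m n : ℕ} (φ : CubeCat.mk m ⟶ CubeCat.mk n) (c : D.obj (op ⟨n⟩))
    (x : Fin m → I) : cubePt (D.map φ.op c) x = cubePt c (cubeExt φ.1 x) :=
  Quot.sound (Glue.mk φ c x)

theorem TopRealization.exists_cubePt (d : TopRealization D) :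
    ∃ (n : ℕ) (c : D.obj (op ⟨n⟩)) (x : Fin n → I), cubePt c x = d := by
  obtain ⟨⟨n, c, x⟩, rfl⟩ := Quot.exists_rep d
  exact ⟨n, c, x, rfl⟩

theorem TopRealization.continuous_iff {f : TopRealization D → Z} :
    Continuous f ↔ ∀ (n : ℕ) (c : D.obj (op ⟨n⟩)), Continuous fun x => f (cubePt c x) := by
  have h : Topology.IsQuotientMap (Quot.mk _ : CubePoints D → TopRealization D) :=
    isQuotientMap_quot_mk
  refine h.continuous_iff.trans (continuous_sigma_iff.trans ?_)
  exact forall_congr' fun n => continuous_sigma_iff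

theorem continuous_cubePt {n : ℕ} (c : D.obj (op ⟨n⟩)) : Continuous (cubePt c) :=
  TopRealization.continuous_iff.1 continuous_id n c

theorem TopRealization.continuous_prod_iff {K : Type w} [TopologicalSpace K]
    [LocallyCompactSpace K] {f : K × TopRealization D → Z} :
    Continuous f ↔ ∀ (n : ℕ) (c : D.obj (op ⟨n⟩)),
      Continuous fun q : K × (Fin n → I) => f (q.1, cubePt c q.2) := by
  refine ⟨fun h n c => h.comp
    (continuous_fst.prodMk ((continuous_cubePt c).comp continuous_snd)), fun h => ?_⟩
  have hd : ∀ d, Continuous fun k => f (k, d) := fun d => by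
    obtain ⟨n, c, x, rfl⟩ := d.exists_cubePt
    exact (h n c).comp (continuous_id.prodMk continuous_const)
  let g : TopRealization D → C(K, Z) := fun d => ⟨_, hd d⟩
  have hg : Continuous g := TopRealization.continuous_iff.2 fun n c =>
    ContinuousMap.continuous_of_continuous_uncurry _ ((h n c).comp continuous_swap)
  exact (ContinuousMap.continuous_uncurry_of_continuous ⟨g, hg⟩).comp continuous_swap

/-- The map from the realization given by a compatible family of maps from cubes. -/
def TopRealization.desc (τ : ∀ n, D.obj (op ⟨n⟩) → C(Fin n → I, Z))
    (h : ∀ (m n : ℕ) (φ : CubeCat.mk m ⟶ CubeCat.mk n) (c : D.obj (op ⟨n⟩)) (x : Fin m → I),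
      τ m (D.map φ.op c) x = τ n c (cubeExt φ.1 x)) : C(TopRealization D, Z) where
  toFun := Quot.lift (fun p => τ p.1 p.2.1 p.2.2) fun _ _ ⟨φ, c, x⟩ => h _ _ φ c x
  continuous_toFun := TopRealization.continuous_iff.2 fun n c => (τ n c).continuous

/-- The cube `c` as a continuous map to the realization. -/
def cubeMap {n : ℕ} (c : D.obj (op ⟨n⟩)) : C(Fin n → I, TopRealization D) :=
  ⟨cubePt c, continuous_cubePt c⟩

end Realization

/-! ### Singular cubes -/

/-- The cubical set of singular cubes of a space. -/
def singularCubes (Z : Type u) [TopologicalSpace Z] : CubicalSet.{u} where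
  obj n := C(Fin n.unop.dim → I, Z)
  map φ := TypeCat.ofHom fun c => c.comp ⟨cubeExt φ.unop.1, continuous_cubeExt _⟩
  map_id n := by
    ext c x
    exact congrArg (DFunLike.coe (F := C(Fin n.unop.dim → I, Z)) c) (cubeExt_id x)
  map_comp {l m n} φ ψ := by
    ext c x
    exact congrArg (DFunLike.coe (F := C(Fin l.unop.dim → I, Z)) c)
      (cubeExt_comp ψ.unop.2.monotone φ.unop.2.monotone x)

section Singular

variable {D : CubicalSet.{u}} {Z : Type u} [TopologicalSpace Z]

/-- A singular cube as a cube of `singularCubes Z`. -/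
def singularCubes.mk {n : ℕ} (c : C(Fin n → I, Z)) : (singularCubes Z).obj (op ⟨n⟩) := c

theorem cubePt_singular {m n : ℕ} (φ : CubeCat.mk m ⟶ CubeCat.mk n) (c : C(Fin n → I, Z))
    (c' : C(Fin m → I, Z)) (h : ∀ x, c' x = c (cubeExt φ.1 x)) (x : Fin m → I) :
    cubePt (singularCubes.mk c') x = cubePt (singularCubes.mk c) (cubeExt φ.1 x) := by
  rw [← cubePt_map φ (singularCubes.mk c) x]
  congr 1
  exact ContinuousMap.ext h

variable (Z) in
/-- The counit: a point of a singular cube is sent to its image. -/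
def singularCounit : C(TopRealization (singularCubes Z), Z) :=
  TopRealization.desc (fun _ c => c) fun _ _ _ _ _ => rfl

@[simp]
theorem singularCounit_cubePt {n : ℕ} (c : C(Fin n → I, Z)) (x : Fin n → I) :
    singularCounit Z (cubePt (singularCubes.mk c) x) = c x := rfl

/-- The canonical lift of a map from a realization through the singular cubes. -/
def toSingular (q : C(TopRealization D, Z)) :
    C(TopRealization D, TopRealization (singularCubes Z)) :=
  TopRealization.desc (fun _ c => cubeMap (singularCubes.mk (q.comp (cubeMap c))))
    fun _ _ φ c x => cubePt_singular φ _ _ (fun y => congrArg q (cubePt_map φ c y)) x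

@[simp]
theorem toSingular_cubePt (q : C(TopRealization D, Z)) {n : ℕ} (c : D.obj (op ⟨n⟩))
    (x : Fin n → I) :
    toSingular q (cubePt c x) = cubePt (singularCubes.mk (q.comp (cubeMap c))) x := rfl

@[simp]
theorem singularCounit_toSingular (q : C(TopRealization D, Z)) (d : TopRealization D) :
    singularCounit Z (toSingular q d) = q d := by
  obtain ⟨n, c, x, rfl⟩ := d.exists_cubePt
  rfl

/-- The slice of a homotopy at time `t`. -/
def slice {T : Type v} [TopologicalSpace T] (H : C(I × T, Z)) (t : I) : C(T, Z) :=
  H.comp ((ContinuousMap.const _ t).prodMk (ContinuousMap.id _))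

@[simp]
theorem slice_apply {T : Type v} [TopologicalSpace T] (H : C(I × T, Z)) (t : I) (x : T) :
    slice H t x = H (t, x) := rfl

/-- The singular cube `I ^ n × I → Z` obtained by restricting a homotopy to an `n`-cube. -/
def prismCube (H : C(I × TopRealization D, Z)) {n : ℕ} (c : D.obj (op ⟨n⟩)) :
    C(Fin (n + 1) → I, Z) where
  toFun x := H (x (Fin.natAdd n 0), cubePt c fun i => x (Fin.castAdd 1 i))
  continuous_toFun := H.continuous.comp ((continuous_apply _).prodMk
    ((continuous_cubePt c).comp (continuous_pi fun _ => continuous_apply _)))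

theorem continuous_finAppend {n : ℕ} :
    Continuous fun q : I × (Fin n → I) => Fin.append q.2 fun _ : Fin 1 => q.1 := by
  refine continuous_pi fun j => Fin.addCases (fun i => ?_) (fun i => ?_) j
  · simp only [Fin.append_left]
    fun_prop
  · simp only [Fin.append_right]
    fun_prop

/-- A homotopy of maps from a realization lifts canonically through the singular cubes: the
restriction of the homotopy to an `n`-cube is a singular `(n + 1)`-cube. -/
theorem exists_toSingular_homotopy (H : C(I × TopRealization D, Z)) :
    ∃ G : C(I × TopRealization D, TopRealization (singularCubes Z)),
      (∀ p, singularCounit Z (G p) = H p) ∧ (∀ d, G (0, d) = toSingular (slice H 0) d) ∧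
        ∀ d, G (1, d) = toSingular (slice H 1) d := by
  let G : I × TopRealization D → TopRealization (singularCubes Z) := fun p =>
    Quot.lift (fun q : CubePoints D => cubePt (singularCubes.mk (prismCube H q.2.1))
      (Fin.append q.2.2 fun _ => p.1)) (by
        rintro _ _ ⟨φ, c, x⟩
        let ψ : CubeCat.mk (_ + 1) ⟶ CubeCat.mk (_ + 1) :=
          ⟨tensorMap φ.1 fun v : Fin 1 → Bool => v, IsCubeMap.tensor φ.2 (IsCubeMap.id 1)⟩
        have hψ : ∀ y, cubeExt ψ.1 y = Fin.append (cubeExt φ.1 fun i => y (Fin.castAdd 1 i))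
            fun i => y (Fin.natAdd _ i) := fun y =>
          (cubeExt_tensorMap (g := fun v : Fin 1 → Bool => v) φ.2.monotone monotone_id y).trans
            (by rw [cubeExt_id])
        refine (cubePt_singular ψ (prismCube H c) _ (fun y => ?_) _).trans ?_
        · rw [hψ]
          simp [prismCube, cubePt_map]
        · rw [hψ]
          simp) p.2
  have hG : ∀ (t : I) (n : ℕ) (c : D.obj (op ⟨n⟩)) (x : Fin n → I), G (t, cubePt c x) =
      cubePt (singularCubes.mk (prismCube H c)) (Fin.append x fun _ => t) := fun _ _ _ _ => rfl
  have hend : ∀ (b : Bool) (d : TopRealization D), G (if b then 1 else 0, d) =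
      toSingular (slice H (if b then 1 else 0)) d := by
    intro b d
    obtain ⟨n, c, x, rfl⟩ := d.exists_cubePt
    let δ : CubeCat.mk n ⟶ CubeCat.mk (n + 1) :=
      ⟨tensorMap (fun v : Fin n → Bool => v) fun (_ : Fin 0 → Bool) (_ : Fin 1) => b,
        IsCubeMap.tensor (IsCubeMap.id n) (IsCubeMap.face b)⟩
    have hδ : ∀ y : Fin n → I, cubeExt δ.1 y = Fin.append y fun _ => if b then 1 else 0 :=
      fun y => (cubeExt_tensorMap (f := fun v : Fin n → Bool => v)
        (g := fun (_ : Fin 0 → Bool) (_ : Fin 1) => b) monotone_id monotone_const y).trans (by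
          rw [cubeExt_id, cubeExt_face]
          rfl)
    rw [hG, toSingular_cubePt, ← hδ]
    refine (cubePt_singular δ _ _ (fun y => ?_) x).symm
    rw [hδ]
    simp [prismCube, cubeMap]
  refine ⟨⟨G, TopRealization.continuous_prod_iff.2 fun n c =>
    (continuous_cubePt (singularCubes.mk (prismCube H c))).comp continuous_finAppend⟩, ?_, hend false, hend true⟩
  rintro ⟨t, d⟩
  obtain ⟨n, c, x, rfl⟩ := d.exists_cubePt
  change singularCounit Z (cubePt (singularCubes.mk (prismCube H c)) (Fin.append x fun _ => t)) = _
  simp [prismCube]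

end Singular

/-! ### Realizations as objects of `Unif` -/

/-- The points of the topological realization. -/
def FineRealization (D : CubicalSet.{u}) : Type u := TopRealization D

/-- The finest uniformity for which all cubes are uniformly continuous. -/
instance (D : CubicalSet.{u}) : UniformSpace (FineRealization D) :=
  sInf { U | ∀ (n : ℕ) (c : D.obj (op ⟨n⟩)),
    @UniformContinuous (Fin n → I) (TopRealization D) _ U (cubePt c) }

/-- The object of `Unif` that represents continuous maps from the topological realization. -/
def fineRealization (D : CubicalSet.{u}) : Unif.{u} :=
  Unif.corefl (SeparationQuotient (FineRealization D))

section Fine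

variable {D : CubicalSet.{u}}

/-- The canonical map from the topological realization. -/
def toFine (d : TopRealization D) : (fineRealization D).obj :=
  (SeparationQuotient.mk (X := FineRealization D) d : SeparationQuotient (FineRealization D))

theorem toFine_surjective : Function.Surjective (toFine (D := D)) :=
  SeparationQuotient.surjective_mk (X := FineRealization D)

theorem uniformContinuous_toFine_cubePt {n : ℕ} (c : D.obj (op ⟨n⟩)) :
    UniformContinuous fun x => toFine (cubePt c x) := by
  have h1 : @UniformContinuous (Fin n → I) (FineRealization D) _ _ (cubePt c) :=
    uniformContinuous_sInf_rng.2 fun _ hU => hU n c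
  have h2 := SeparationQuotient.uniformContinuous_mk.comp h1
  have h3 := Corefl.uniformContinuous_test _ _ _ (isConnMetric_ulift.{u} (Fin n → I))
    (h2.comp uniformContinuous_uliftDown)
  exact h3.comp uniformContinuous_uliftUp

/-- Continuous maps from the topological realization to objects of `Unif` extend to
`fineRealization D`. -/
theorem exists_fineRealization_desc {Z : Unif.{u}} (f : C(TopRealization D, Z.obj)) :
    ∃ g : fineRealization D ⟶ Z, ∀ d, Unif.toMap g (toFine d) = f d := by
  have h1 : @UniformContinuous (FineRealization D) Z.obj _ _ f :=
    uniformContinuous_iff_le_comap.2 <| sInf_le (α := UniformSpace (FineRealization D))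
      fun n c => uniformContinuous_comap' (CompactSpace.uniformContinuous_of_continuous
        (f.continuous.comp (continuous_cubePt c)))
  have h2 : ∀ x y : FineRealization D, Inseparable x y → f x = f y := fun x y h =>
    (h.map h1.continuous).eq
  have h3 : UniformContinuous (SeparationQuotient.lift (X := FineRealization D) f h2) :=
    (SeparationQuotient.uniformContinuous_lift h2).2 h1
  exact ⟨Unif.mkHom (X := fineRealization D) _ (h3.comp (Corefl.uniformContinuous_id _)),
    fun _ => rfl⟩

end Fine

/-! ### Lifting paths relative to their end points -/

section PathLifting

variable {E B : Type u} [TopologicalSpace E] [TopologicalSpace B]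

/-- The homotopy lifting property for homotopies of paths. -/
def LiftsPathHomotopies (F : C(E, B)) : Prop :=
  ∀ (Γ : C(I × I, B)) (h : C(I, E)), (∀ t, F (h t) = Γ (0, t)) →
    ∃ L : C(I × I, E), (∀ t, L (0, t) = h t) ∧ ∀ p, F (L p) = Γ p

/-- A homotopy of paths relative to the end points may be run at a speed that depends on the point
`t`, even when that speed tends to infinity at the end points. -/
theorem continuous_speedUp (Γ : C(I × I, B)) (h0 : ∀ s, Γ (s, 0) = Γ (0, 0))
    (h1 : ∀ s, Γ (s, 1) = Γ (0, 1)) : Continuous fun p : I × I =>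
      Γ (Set.projIcc 0 1 zero_le_one ((p.1 : ℝ) / min (p.2 : ℝ) (1 - p.2)), p.2) := by
  rw [continuous_iff_continuousAt]
  rintro ⟨s, t⟩
  by_cases ht : min (t : ℝ) (1 - t) = 0
  · -- At an end point `Γ` does not depend on the first variable, so that by compactness
    -- nearby values are close whatever the first variable is.
    have hc : ∀ s', Γ (s', t) = Γ (0, t) := by
      rcases min_choice (t : ℝ) (1 - t) with h | h
      · have : t = 0 := Subtype.ext (h ▸ ht)
        exact this ▸ h0
      · have : t = 1 := Subtype.ext (by rw [h] at ht; simpa using (sub_eq_zero.1 ht).symm)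
        exact this ▸ h1
    rw [ContinuousAt, hc]
    intro V hV
    have hV' : ∀ s' ∈ (Set.univ : Set I), ∀ᶠ q : I × I in nhds (t, s'), Γ (q.2, q.1) ∈ V := by
      intro s' _
      have : Continuous fun q : I × I => Γ (q.2, q.1) := Γ.continuous.comp continuous_swap
      exact this.continuousAt (by rwa [hc s'])
    have h2 := isCompact_univ.eventually_forall_of_forall_eventually
      (P := fun a b => Γ (b, a) ∈ V) hV'
    exact (continuous_snd.tendsto (s, t)).eventually h2 |>.mono fun q hq => hq _ trivial
  · have : ContinuousAt (fun p : I × I => (p.1 : ℝ) / min (p.2 : ℝ) (1 - p.2)) (s, t) :=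
      ContinuousAt.div (by fun_prop) (by fun_prop) ht
    exact Γ.continuous.continuousAt.comp
      ((continuous_projIcc.continuousAt.comp this).prodMk continuousAt_snd)

/-- A path that is homotopic relative to the end points to the image of a path lifts with the same
end points. -/
theorem LiftsPathHomotopies.exists_lift_of_homotopic {F : C(E, B)} (hF : LiftsPathHomotopies F)
    {e₀ e₁ : E} (p : Path e₀ e₁) (q : Path (F e₀) (F e₁))
    (h : (p.map F.continuous).Homotopic q) : ∃ p' : Path e₀ e₁, ∀ t, F (p' t) = q t := by
  obtain ⟨Γ⟩ := h
  -- The lift of the accelerated homotopy, evaluated where it has just come to an end.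
  obtain ⟨L, hL, hFL⟩ := hF ⟨_, continuous_speedUp (Γ : C(I × I, B)) (by simp) (by simp)⟩ p
    (fun t => by simp)
  have hmin : ∀ t : I, min (t : ℝ) (1 - t) ∈ I := fun t =>
    ⟨le_min t.2.1 (sub_nonneg.2 t.2.2), (min_le_left _ _).trans t.2.2⟩
  let τ : I → I := fun t => ⟨min (t : ℝ) (1 - t), hmin t⟩
  have hτ : Continuous τ := Continuous.subtype_mk (by fun_prop) _
  have hτ0 : τ 0 = 0 := Subtype.ext (by simp [τ])
  have hτ1 : τ 1 = 0 := Subtype.ext (by simp [τ])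
  refine ⟨⟨⟨fun t => L (τ t, t), L.continuous.comp (hτ.prodMk continuous_id)⟩, ?_, ?_⟩, fun t => ?_⟩
  · simp [hτ0, hL]
  · simp [hτ1, hL]
  · change F (L (τ t, t)) = q t
    rw [hFL]
    change Γ (Set.projIcc 0 1 zero_le_one ((τ t : ℝ) / τ t), t) = q t
    by_cases h0 : (τ t : ℝ) = 0
    · rcases min_choice (t : ℝ) (1 - t) with h | h
      · have : t = 0 := Subtype.ext (h ▸ h0)
        subst this
        simp
      · have : t = 1 := Subtype.ext (by
          change min (t : ℝ) (1 - t) = 0 at h0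
          rw [h] at h0
          simpa using (sub_eq_zero.1 h0).symm)
        subst this
        simp
    · rw [div_self h0, Set.projIcc_right]
      exact Γ.apply_one t

/-- The conjugate of a path by `n₀` and `n₁`, conjugated back, is homotopic to the path.  The end
points of `g` are only propositionally equal to those of the path. -/
theorem homotopic_conj {b₀ b₁ b₀' b₁' : B} (h₀ : b₀' = b₀) (h₁ : b₁' = b₁) (n₀ : Path b₀' b₀)
    (n₁ : Path b₁' b₁) (γ : Path b₀ b₁) (g : Path b₀' b₁')
    (hg : ∀ t, g t = ((n₀.cast h₀.symm rfl).trans (γ.trans (n₁.cast h₁.symm rfl).symm)) t) :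
    (n₀.symm.trans (g.trans n₁)).Homotopic γ := by
  subst h₀ h₁
  obtain rfl : g = n₀.trans (γ.trans n₁.symm) := by
    ext t
    exact hg t
  rw [← Path.Homotopic.Quotient.eq]
  simp only [Path.Homotopic.Quotient.mk_trans, Path.Homotopic.Quotient.mk_symm,
    Path.Homotopic.Quotient.trans_assoc, Path.Homotopic.Quotient.symm_trans,
    Path.Homotopic.Quotient.trans_refl]
  rw [← Path.Homotopic.Quotient.trans_assoc, Path.Homotopic.Quotient.symm_trans,
    Path.Homotopic.Quotient.refl_trans]

/-- Suppose that `F` has a section `s` that also lifts paths and such that `s ∘ F` is pointwise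
joined to the identity.  Then paths in the base lift with prescribed end points.  The path `N e`
from `s (F e)` to `e` need not be vertical; conjugating by it and lifting, by means of `s`, the path
conjugated by its image gives a lift up to homotopy relative to the end points. -/
theorem LiftsPathHomotopies.exists_lift_of_section {F : C(E, B)} (hF : LiftsPathHomotopies F)
    (s : B → E) (hs : ∀ b, F (s b) = b)
    (hp : ∀ b₀ b₁ (γ : Path b₀ b₁), ∃ γ' : Path (s b₀) (s b₁), ∀ t, F (γ' t) = γ t)
    (hN : ∀ e, Joined (s (F e)) e) {e₀ e₁ : E} (γ : Path (F e₀) (F e₁)) :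
    ∃ γ' : Path e₀ e₁, ∀ t, F (γ' t) = γ t := by
  obtain ⟨N₀⟩ := hN e₀
  obtain ⟨N₁⟩ := hN e₁
  obtain ⟨g, hg⟩ := hp _ _ (((N₀.map F.continuous).cast (hs _).symm rfl).trans
    (γ.trans ((N₁.map F.continuous).cast (hs _).symm rfl).symm))
  refine hF.exists_lift_of_homotopic (N₀.symm.trans (g.trans N₁)) γ ?_
  rw [Path.map_trans, Path.map_trans, ← Path.map_symm]
  exact homotopic_conj (hs _) (hs _) _ _ γ _ hg

theorem LiftsPaths.surjective {P Q : Type u} [TopologicalSpace P] [TopologicalSpace Q]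
    {F : C(P, Q)} (hF : LiftsPaths F) (h : ∀ q, ∃ p, Joined (F p) q) : Function.Surjective F := by
  intro q
  obtain ⟨p, ⟨γ⟩⟩ := h q
  obtain ⟨γ', -, h1⟩ := hF γ.toContinuousMap p γ.source.symm
  exact ⟨γ' 1, (DFunLike.congr_fun h1 1).trans γ.target⟩

end PathLifting

/-- Three sides of a square can be filled. -/
theorem exists_square {P : Type u} [TopologicalSpace P] (g α β : C(I, P)) (h0 : α 0 = g 0)
    (h1 : β 0 = g 1) : ∃ L : C(I × I, P), (∀ t, L (0, t) = g t) ∧ (∀ s, L (s, 0) = α s) ∧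
      ∀ s, L (s, 1) = β s := by
  let pr : ℝ → I := Set.projIcc 0 1 zero_le_one
  have hpr : Continuous pr := continuous_projIcc
  have hpr0 : ∀ x ≤ (0 : ℝ), pr x = 0 := fun x hx => Set.projIcc_of_le_left _ hx
  have hpr1 : pr 1 = 1 := Set.projIcc_right _
  have hprI : ∀ t : I, pr t = t := fun t => Set.projIcc_val _ t
  -- At time `s` the path runs through `α` backwards from `s`, through `g`, and through `β` up to
  -- `s`, the outer parts taking a third of `s` each.
  let L : I × I → P := fun p =>
    if 3 * (p.2 : ℝ) ≤ p.1 then α (pr (p.1 - 3 * p.2))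
    else if 3 * (1 - (p.2 : ℝ)) ≤ p.1 then β (pr (p.1 - 3 * (1 - p.2)))
    else g (pr ((3 * p.2 - p.1) / (3 - 2 * p.1)))
  have hpos : ∀ s : I, (0 : ℝ) < 3 - 2 * s := fun s => by linarith [s.2.2]
  have hL : Continuous L := by
    refine Continuous.if_le (by fun_prop) (Continuous.if_le (by fun_prop) ?_ (by fun_prop)
      (by fun_prop) ?_) (by fun_prop) (by fun_prop) ?_
    · exact g.continuous.comp (hpr.comp (Continuous.div (by fun_prop) (by fun_prop)
        fun p => (hpos p.1).ne'))
    · intro p hp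
      have : (3 * (p.2 : ℝ) - p.1) / (3 - 2 * p.1) = 1 := by
        rw [div_eq_one_iff_eq (hpos p.1).ne']
        linarith
      rw [this, hpr1, hp, sub_self, hpr0 0 le_rfl, h1]
    · intro p hp
      have : ¬ 3 * (1 - (p.2 : ℝ)) ≤ p.1 := by linarith [p.1.2.2]
      rw [if_neg this, hp, sub_self, zero_div, hpr0 0 le_rfl, h0]
  refine ⟨⟨L, hL⟩, fun t => ?_, fun s => ?_, fun s => ?_⟩
  · change (if 3 * (t : ℝ) ≤ (0 : I) then α (pr ((0 : I) - 3 * t)) else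
      if 3 * (1 - (t : ℝ)) ≤ (0 : I) then β (pr ((0 : I) - 3 * (1 - t)))
      else g (pr ((3 * t - (0 : I)) / (3 - 2 * (0 : I))))) = g t
    split_ifs with h2 h3
    · have : t = 0 := Subtype.ext (le_antisymm (by simp at h2 ⊢; linarith) t.2.1)
      subst this
      simpa [hpr0] using h0
    · have : t = 1 := Subtype.ext (le_antisymm t.2.2 (by simp at h3 ⊢; linarith))
      subst this
      simpa [hpr0] using h1
    · have : (3 * (t : ℝ) - (0 : I)) / (3 - 2 * (0 : I)) = t := by simp
      rw [this, hprI]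
  · change (if 3 * ((0 : I) : ℝ) ≤ s then α (pr (s - 3 * (0 : I))) else _) = α s
    rw [if_pos (by simpa using s.2.1)]
    simp [hprI]
  · change (if 3 * ((1 : I) : ℝ) ≤ s then _ else
      if 3 * (1 - ((1 : I) : ℝ)) ≤ s then β (pr (s - 3 * (1 - (1 : I)))) else _) = β s
    rw [if_neg (by have := s.2.2; simp; linarith), if_pos (by simpa using s.2.1)]
    simp [hprI]

/-! ### Homotopy classes -/

theorem postcomp_bijective_iff {T : Type v} {X Y : Type w} [TopologicalSpace T]
    [TopologicalSpace X] [TopologicalSpace Y] (F : C(X, Y)) :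
    Function.Bijective (HomotopyClasses.postcomp T F) ↔
      (∀ q₀ q₁ : C(T, X), (F.comp q₀).Homotopic (F.comp q₁) → q₀.Homotopic q₁) ∧
        ∀ r : C(T, Y), ∃ q : C(T, X), (F.comp q).Homotopic r := by
  refine and_congr ⟨fun h q₀ q₁ hq => ?_, fun h x y hxy => ?_⟩ ⟨fun h r => ?_, fun h y => ?_⟩
  · exact Quotient.exact (@h (Quotient.mk _ q₀) (Quotient.mk _ q₁) (Quotient.sound hq))
  · induction x using Quotient.inductionOn with | _ q₀
    induction y using Quotient.inductionOn with | _ q₁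
    exact Quotient.sound (h q₀ q₁ (Quotient.exact hxy))
  · obtain ⟨x, hx⟩ := h (Quotient.mk _ r)
    induction x using Quotient.inductionOn with | _ q
    exact ⟨q, Quotient.exact hx⟩
  · induction y using Quotient.inductionOn with | _ r
    obtain ⟨q, hq⟩ := h r
    exact ⟨Quotient.mk _ q, Quotient.sound hq⟩

theorem postcomp_comp {T : Type v} {X Y Z : Type w} [TopologicalSpace T] [TopologicalSpace X]
    [TopologicalSpace Y] [TopologicalSpace Z] (F : C(X, Y)) (G : C(Y, Z)) :
    HomotopyClasses.postcomp T (G.comp F) =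
      HomotopyClasses.postcomp T G ∘ HomotopyClasses.postcomp T F := by
  funext x
  induction x using Quotient.inductionOn with | _ q
  rfl

section Fibrant

open MonoidalCategory CartesianMonoidalCategory MonoidalClosed

variable [CartesianMonoidalCategory Unif.{u}] [MonoidalClosed Unif.{u}] {A X Y Z : Unif.{u}}

/-! ### Maps from realizations to exponential objects -/

section Adjunction

variable {D : CubicalSet.{u}}

theorem ev_pair_toFine_ext {θ θ' : ((ihom (A ⊗ fineRealization D)).obj X).obj}
    (h : ∀ a d, Unif.ev θ (Unif.pair a (toFine d)) = Unif.ev θ' (Unif.pair a (toFine d))) :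
    θ = θ' :=
  Unif.ev_ext fun z => by
    obtain ⟨d, hd⟩ := toFine_surjective (Unif.toMap (snd A (fineRealization D)) z)
    rw [← Unif.pair_eta z, ← hd]
    exact h _ d

section Family

variable {K : Type} [MetricSpace K] [CompactSpace K] [ConnectedSpace K] [LocallyConnectedSpace K]

/-- A continuous family of maps from a realization to `X ^ A` is a continuous family of points of
`X ^ (A ⊗ fineRealization D)`. -/
theorem exists_family_of_continuousMap (H : C(K × TopRealization D, ((ihom A).obj X).obj)) :
    ∃ θ : C(K, ((ihom (A ⊗ fineRealization D)).obj X).obj), ∀ k a d,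
      Unif.ev (θ k) (Unif.pair a (toFine d)) = Unif.ev (H (k, d)) a := by
  -- A continuous map from the realization to `(X ^ A) ^ K` descends to `fineRealization D`.
  choose G hG using fun d : TopRealization D =>
    Unif.exists_ev_eq (A := Unif.ofCompact K) (X := (ihom A).obj X) (fun k => H (k.down, d))
      ((CompactSpace.uniformContinuous_of_continuous (H.continuous.comp
        (continuous_id.prodMk continuous_const))).comp uniformContinuous_uliftDown)
  have hGc : Continuous G := by
    refine TopRealization.continuous_iff.2 fun n c => Unif.continuous_exp_iff.2 ?_
    simp only [hG]
    refine Unif.jointUC_ofCompact_iff.2 ?_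
    exact H.continuous.comp
      (continuous_snd.prodMk ((continuous_cubePt c).comp continuous_fst))
  obtain ⟨g, hg⟩ := exists_fineRealization_desc ⟨G, hGc⟩
  obtain ⟨θ, hθ⟩ := Unif.exists_curry (K := K) (A := A) (B := fineRealization D) (X := X)
    (H := fun k b => Unif.ev (Unif.toMap g b) (ULift.up k)) fun N hN t b ht hb =>
      Unif.uniformContinuous_ev (A := Unif.ofCompact K) hN
        ((Unif.uniformContinuous_toMap g).comp hb) (uniformContinuous_uliftUp.comp ht)
  refine ⟨θ, fun k a d => ?_⟩
  rw [hθ, hg]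
  exact congrArg (fun z => Unif.ev z a) (hG d (ULift.up k))

/-- A continuous family of points of `X ^ (A ⊗ fineRealization D)` is a continuous family of maps
from the realization to `X ^ A`. -/
theorem exists_continuousMap_of_family (θ : C(K, ((ihom (A ⊗ fineRealization D)).obj X).obj)) :
    ∃ H : C(K × TopRealization D, ((ihom A).obj X).obj), ∀ k a d,
      Unif.ev (H (k, d)) a = Unif.ev (θ k) (Unif.pair a (toFine d)) := by
  obtain ⟨H, hH, h⟩ := Unif.exists_uncurry θ
  refine ⟨⟨fun p => H p.1 (toFine p.2), TopRealization.continuous_prod_iff.2 fun n c =>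
    Unif.continuous_exp_iff.2 fun N hN t a ht ha => ?_⟩, fun k a d => h k a _⟩
  exact Unif.uniformContinuous_ev hN (hH N hN (fun k => (t k).1) (fun k => toFine (cubePt c (t k).2))
    (uniformContinuous_fst.comp ht)
    ((uniformContinuous_toFine_cubePt c).comp (uniformContinuous_snd.comp ht))) ha

end Family

theorem exists_point_of_continuousMap (q : C(TopRealization D, ((ihom A).obj X).obj)) :
    ∃ θ : ((ihom (A ⊗ fineRealization D)).obj X).obj, ∀ a d,
      Unif.ev θ (Unif.pair a (toFine d)) = Unif.ev (q d) a := by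
  obtain ⟨θ, hθ⟩ := exists_family_of_continuousMap (K := Unit)
    (q.comp ContinuousMap.snd : C(Unit × TopRealization D, _))
  exact ⟨θ (), hθ ()⟩

theorem exists_continuousMap_of_point (θ : ((ihom (A ⊗ fineRealization D)).obj X).obj) :
    ∃ q : C(TopRealization D, ((ihom A).obj X).obj), ∀ a d,
      Unif.ev (q d) a = Unif.ev θ (Unif.pair a (toFine d)) := by
  obtain ⟨H, hH⟩ := exists_continuousMap_of_family (K := Unit) (ContinuousMap.const _ θ)
  exact ⟨H.comp ((ContinuousMap.const _ ()).prodMk (ContinuousMap.id _)), fun a d => hH () a d⟩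

variable (A X D) in
/-- Continuous maps from the realization of `D` to `X ^ A` are the points of
`X ^ (A ⊗ fineRealization D)`. -/
noncomputable def mapEquiv : C(TopRealization D, ((ihom A).obj X).obj) ≃
    ((ihom (A ⊗ fineRealization D)).obj X).obj where
  toFun q := (exists_point_of_continuousMap q).choose
  invFun θ := (exists_continuousMap_of_point θ).choose
  left_inv q := ContinuousMap.ext fun d => Unif.ev_ext fun a => by
    rw [(exists_continuousMap_of_point _).choose_spec,
      (exists_point_of_continuousMap q).choose_spec]
  right_inv θ := ev_pair_toFine_ext fun a d => by
    rw [(exists_point_of_continuousMap _).choose_spec,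
      (exists_continuousMap_of_point θ).choose_spec]

theorem ev_mapEquiv (q : C(TopRealization D, ((ihom A).obj X).obj)) (a : A.obj)
    (d : TopRealization D) :
    Unif.ev (mapEquiv A X D q) (Unif.pair a (toFine d)) = Unif.ev (q d) a :=
  (exists_point_of_continuousMap q).choose_spec a d

theorem mapEquiv_comp (f : X ⟶ Y) (q : C(TopRealization D, ((ihom A).obj X).obj)) :
    mapEquiv A Y D ((homMap A f).comp q) =
      homMap (A ⊗ fineRealization D) f (mapEquiv A X D q) :=
  ev_pair_toFine_ext fun a d => by
    rw [ev_mapEquiv, Unif.ev_homMap, ev_mapEquiv, ContinuousMap.comp_apply, Unif.ev_homMap]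

theorem mapEquiv_symm_homMap (f : X ⟶ Y) (θ : ((ihom (A ⊗ fineRealization D)).obj X).obj) :
    (mapEquiv A Y D).symm (homMap (A ⊗ fineRealization D) f θ) =
      (homMap A f).comp ((mapEquiv A X D).symm θ) := by
  rw [Equiv.symm_apply_eq, mapEquiv_comp, Equiv.apply_symm_apply]

/-- Homotopies of maps from the realization correspond to paths. -/
theorem exists_path_of_homotopy (H : C(I × TopRealization D, ((ihom A).obj X).obj)) :
    ∃ γ : C(I, ((ihom (A ⊗ fineRealization D)).obj X).obj),
      ∀ t, γ t = mapEquiv A X D (slice H t) := by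
  obtain ⟨γ, hγ⟩ := exists_family_of_continuousMap H
  exact ⟨γ, fun t => ev_pair_toFine_ext fun a d => by rw [hγ, ev_mapEquiv, slice_apply]⟩

theorem exists_homotopy_of_path (γ : C(I, ((ihom (A ⊗ fineRealization D)).obj X).obj)) :
    ∃ H : C(I × TopRealization D, ((ihom A).obj X).obj),
      ∀ t, mapEquiv A X D (slice H t) = γ t := by
  obtain ⟨H, hH⟩ := exists_continuousMap_of_family γ
  exact ⟨H, fun t => ev_pair_toFine_ext fun a d => by rw [ev_mapEquiv, slice_apply, hH]⟩

theorem homotopic_iff_joined (q₀ q₁ : C(TopRealization D, ((ihom A).obj X).obj)) :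
    q₀.Homotopic q₁ ↔ Joined (mapEquiv A X D q₀) (mapEquiv A X D q₁) := by
  constructor
  · rintro ⟨H⟩
    obtain ⟨γ, hγ⟩ := exists_path_of_homotopy H.toContinuousMap
    refine ⟨⟨γ, ?_, ?_⟩⟩
    · rw [ContinuousMap.toFun_eq_coe, hγ]
      exact congrArg _ (ContinuousMap.ext fun d => H.apply_zero d)
    · rw [ContinuousMap.toFun_eq_coe, hγ]
      exact congrArg _ (ContinuousMap.ext fun d => H.apply_one d)
  · rintro ⟨γ⟩
    obtain ⟨H, hH⟩ := exists_homotopy_of_path γ.toContinuousMap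
    have h0 : slice H 0 = q₀ := (mapEquiv A X D).injective ((hH 0).trans γ.source)
    have h1 : slice H 1 = q₁ := (mapEquiv A X D).injective ((hH 1).trans γ.target)
    exact ⟨⟨H, fun d => DFunLike.congr_fun h0 d, fun d => DFunLike.congr_fun h1 d⟩⟩

end Adjunction

/-- A continuous map that induces a bijection on path components. -/
def PiZeroBijective {P Q : Type u} [TopologicalSpace P] [TopologicalSpace Q] (F : C(P, Q)) : Prop :=
  (∀ p₀ p₁, Joined (F p₀) (F p₁) → Joined p₀ p₁) ∧ ∀ q, ∃ p, Joined (F p) q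

/-- Weak equivalences are detected on path components of exponential objects. -/
theorem isClassicalWeakEquiv_homMap_iff (f : X ⟶ Y) : IsClassicalWeakEquiv (homMap A f) ↔
    ∀ D : CubicalSet.{u}, PiZeroBijective (homMap (A ⊗ fineRealization D) f) := by
  refine forall_congr' fun D => ?_
  rw [postcomp_bijective_iff, PiZeroBijective]
  simp only [homotopic_iff_joined, mapEquiv_comp]
  refine and_congr ⟨fun h p₀ p₁ => ?_, fun h q₀ q₁ => h _ _⟩ ⟨fun h q => ?_, fun h r => ?_⟩
  · simpa using h ((mapEquiv A X D).symm p₀) ((mapEquiv A X D).symm p₁)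
  · obtain ⟨p, hp⟩ := h ((mapEquiv A Y D).symm q)
    exact ⟨_, by simpa using hp⟩
  · obtain ⟨p, hp⟩ := h (mapEquiv A Y D r)
    exact ⟨(mapEquiv A X D).symm p, by simpa using hp⟩

/-! ### Acyclic fibrations -/

/-- A uniform Hurewicz fibration lifts homotopies of paths: these are paths in another
exponential object. -/
theorem liftsPathHomotopies_homMap {f : X ⟶ Y} (hf : uniformHurewiczFibrations f) (A : Unif.{u}) :
    LiftsPathHomotopies (homMap A f) := by
  intro Γ h hh
  obtain ⟨γ, hγ⟩ := Unif.exists_curry (K := I) (A := A) (B := Unif.ofCompact I) (X := Y)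
    (H := fun s t => Γ (s, t.down)) (Unif.jointUC_ofCompact_iff.2 Γ.continuous)
  obtain ⟨x, hx⟩ := Unif.exists_curry (K := Unit) (A := A) (B := Unif.ofCompact I) (X := X)
    (H := fun _ t => h t.down) (Unif.jointUC_ofCompact_iff.2 (h.continuous.comp continuous_snd))
  obtain ⟨γ', h0, h1⟩ := hf (A ⊗ Unif.ofCompact I) γ (x ()) <| Unif.ev_ext fun z => by
    rw [← Unif.pair_eta z, hγ, Unif.ev_homMap, hx, ← Unif.ev_homMap, hh]
  obtain ⟨L, hL, hL'⟩ := Unif.exists_uncurry γ'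
  refine ⟨⟨fun p => L p.1 (ULift.up p.2), Unif.jointUC_ofCompact_iff.1 hL⟩, fun t => ?_,
    fun p => ?_⟩
  · refine Unif.ev_ext fun a => (hL' 0 a (ULift.up t)).trans ?_
    rw [h0]
    exact hx () a (ULift.up t)
  · refine Unif.ev_ext fun a => (Unif.ev_homMap f _ a).trans
      ((congrArg (Unif.toMap f) (hL' p.1 a (ULift.up p.2))).trans ?_)
    rw [← Unif.ev_homMap, ← ContinuousMap.comp_apply, h1]
    exact hγ p.1 a (ULift.up p.2)

/-- Along an acyclic fibration, paths in exponential objects lift with prescribed end points. The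
section required for this comes from the cubical sets of singular cubes: bijectivity on homotopy
classes for `singularCubes (Y ^ A)` and `singularCubes (X ^ A)` yields a natural way to lift
singular cubes, and a natural homotopy from the lift of the image of a singular cube to the singular
cube itself. -/
theorem exists_lift_path {f : X ⟶ Y} (hf : uniformHurewiczFibrations f)
    (hw : IsClassicalWeakEquiv (homMap A f)) (D : CubicalSet.{u})
    {e₀ e₁ : ((ihom (A ⊗ fineRealization D)).obj X).obj}
    (γ : Path (homMap (A ⊗ fineRealization D) f e₀) (homMap (A ⊗ fineRealization D) f e₁)) :
    ∃ γ' : Path e₀ e₁, ∀ t, homMap (A ⊗ fineRealization D) f (γ' t) = γ t := by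
  set F := homMap A f with hFdef
  obtain ⟨s, hs⟩ : ∃ s : C(TopRealization (singularCubes ((ihom A).obj Y).obj),
      ((ihom A).obj X).obj), F.comp s = singularCounit _ := by
    obtain ⟨θ, hθ⟩ := (hf _).surjective ((isClassicalWeakEquiv_homMap_iff f).1 hw _).2
      (mapEquiv A Y _ (singularCounit ((ihom A).obj Y).obj))
    refine ⟨(mapEquiv A X _).symm θ, ?_⟩
    rw [hFdef, ← mapEquiv_symm_homMap, hθ, Equiv.symm_apply_apply]
  obtain ⟨N⟩ : (s.comp (toSingular (F.comp (singularCounit ((ihom A).obj X).obj)))).Homotopic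
      (singularCounit _) := by
    refine ((postcomp_bijective_iff F).1 (hw _)).1 _ _ ?_
    rw [← ContinuousMap.comp_assoc, hs]
    convert ContinuousMap.Homotopic.refl _ using 1
    exact ContinuousMap.ext fun d => (singularCounit_toSingular _ d).symm
  refine (liftsPathHomotopies_homMap hf _).exists_lift_of_section
    (fun b => mapEquiv A X D (s.comp (toSingular ((mapEquiv A Y D).symm b)))) (fun b => ?_)
    (fun b₀ b₁ δ => ?_) (fun e => ?_) γ
  · rw [← mapEquiv_comp, ← ContinuousMap.comp_assoc, hs, ← Equiv.eq_symm_apply]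
    exact ContinuousMap.ext fun d => singularCounit_toSingular _ d
  · obtain ⟨H, hH⟩ := exists_homotopy_of_path δ.toContinuousMap
    obtain ⟨G, hG, hG0, hG1⟩ := exists_toSingular_homotopy H
    obtain ⟨δ', hδ'⟩ := exists_path_of_homotopy (s.comp G)
    have h0 : slice H 0 = (mapEquiv A Y D).symm b₀ :=
      (Equiv.eq_symm_apply _).2 ((hH 0).trans δ.source)
    have h1 : slice H 1 = (mapEquiv A Y D).symm b₁ :=
      (Equiv.eq_symm_apply _).2 ((hH 1).trans δ.target)
    refine ⟨⟨δ', ?_, ?_⟩, fun t => ?_⟩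
    · rw [ContinuousMap.toFun_eq_coe, hδ', ← h0]
      exact congrArg _ (ContinuousMap.ext fun d => congrArg s (hG0 d))
    · rw [ContinuousMap.toFun_eq_coe, hδ', ← h1]
      exact congrArg _ (ContinuousMap.ext fun d => congrArg s (hG1 d))
    · change homMap _ f (δ' t) = _
      rw [hδ', ← mapEquiv_comp]
      refine Eq.trans (congrArg _ (ContinuousMap.ext fun d => ?_)) (hH t)
      exact (DFunLike.congr_fun hs (G (t, d))).trans (hG (t, d))
  · set q := (mapEquiv A X D).symm e with hq
    have key : (s.comp (toSingular (F.comp q))).Homotopic q := by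
      have := ContinuousMap.Homotopic.comp ⟨N⟩ (ContinuousMap.Homotopic.refl (toSingular q))
      convert this using 1
      · refine ContinuousMap.ext fun d => congrArg s ?_
        obtain ⟨n, c, x, rfl⟩ := d.exists_cubePt
        rfl
      · exact ContinuousMap.ext fun d => (singularCounit_toSingular q d).symm
    rw [homotopic_iff_joined] at key
    rw [mapEquiv_symm_homMap]
    simpa [hq] using key

/-! ### Functoriality -/

theorem homMap_comp (A : Unif.{u}) (f : X ⟶ Y) (g : Y ⟶ Z) :
    homMap A (f ≫ g) = (homMap A g).comp (homMap A f) :=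
  ContinuousMap.ext fun φ => Unif.ev_ext fun a => by simp

theorem homMap_id (A X : Unif.{u}) : homMap A (𝟙 X) = ContinuousMap.id _ :=
  ContinuousMap.ext fun φ => Unif.ev_ext fun a => by simp

theorem hom_inv_homMap (A : Unif.{u}) (f : X ⟶ Y) [IsIso f] :
    (homMap A (inv f)).comp (homMap A f) = ContinuousMap.id _ := by
  rw [← homMap_comp, IsIso.hom_inv_id, homMap_id]

theorem inv_hom_homMap (A : Unif.{u}) (f : X ⟶ Y) [IsIso f] :
    (homMap A f).comp (homMap A (inv f)) = ContinuousMap.id _ := by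
  rw [← homMap_comp, IsIso.inv_hom_id, homMap_id]

theorem weakEquivalences_of_isIso (f : X ⟶ Y) (_ : IsIso f) : uniformWeakEquivalences f := by
  intro C
  rw [isClassicalWeakEquiv_homMap_iff]
  refine fun D => ⟨fun p₀ p₁ h => ?_, fun q => ⟨homMap _ (inv f) q, ?_⟩⟩
  · have := h.map (homMap _ (inv f)).continuous
    rwa [← ContinuousMap.comp_apply, ← ContinuousMap.comp_apply, hom_inv_homMap] at this
  · rw [← ContinuousMap.comp_apply, inv_hom_homMap]
    exact Joined.refl q

theorem fibrations_of_isIso (f : X ⟶ Y) (_ : IsIso f) : uniformHurewiczFibrations f := by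
  intro A γ x hx
  refine ⟨(homMap A (inv f)).comp γ, ?_, ?_⟩
  · rw [ContinuousMap.comp_apply, ← hx, ← ContinuousMap.comp_apply, hom_inv_homMap]
    rfl
  · rw [← ContinuousMap.comp_assoc, inv_hom_homMap, ContinuousMap.id_comp]

theorem fibrations_comp : (uniformHurewiczFibrations.{u}).IsStableUnderComposition where
  comp_mem f g hf hg A γ x hx := by
    rw [homMap_comp] at hx ⊢
    obtain ⟨γ₁, h0, h1⟩ := hg A γ (homMap A f x) hx
    obtain ⟨γ₂, h2, h3⟩ := hf A γ₁ x h0.symm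
    exact ⟨γ₂, h2, by rw [ContinuousMap.comp_assoc, h3, h1]⟩

theorem postcomp_homMap_comp (A : Unif.{u}) (T : Type u) [TopologicalSpace T] (f : X ⟶ Y)
    (g : Y ⟶ Z) : HomotopyClasses.postcomp T (homMap A (f ≫ g)) =
      HomotopyClasses.postcomp T (homMap A g) ∘ HomotopyClasses.postcomp T (homMap A f) := by
  rw [homMap_comp, postcomp_comp]

theorem weakEquivalences_twoOutOfThree :
    (uniformWeakEquivalences.{u}).HasTwoOutOfThreeProperty where
  comp_mem f g hf hg C D := by
    rw [postcomp_homMap_comp]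
    exact (hg C D).comp (hf C D)
  of_postcomp f g hg hfg C D := by
    have := hfg C D
    rw [postcomp_homMap_comp] at this
    exact (Function.Bijective.of_comp_iff' (hg C D) _).1 this
  of_precomp f g hf hfg C D := by
    have := hfg C D
    rw [postcomp_homMap_comp] at this
    exact (Function.Bijective.of_comp_iff _ (hf C D)).1 this

/-! ### Base change -/

section Pullback

variable {P S : Unif.{u}} {fst : P ⟶ X} {snd : P ⟶ Y} {f : X ⟶ S} {g : Y ⟶ S}

theorem homMap_pullback_ext (sq : IsPullback fst snd f g) {p q : ((ihom A).obj P).obj}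
    (h1 : homMap A fst p = homMap A fst q) (h2 : homMap A snd p = homMap A snd q) : p = q := by
  have : PreservesLimitsOfSize.{0, 0} (ihom A) := (ihom.adjunction A).rightAdjoint_preservesLimits
  have sq' := sq.map (ihom A)
  have : Unif.const p = Unif.const q := sq'.hom_ext (Unif.hom_ext fun _ => h1)
    (Unif.hom_ext fun _ => h2)
  exact Unif.toMap_congr this PUnit.unit

theorem exists_pullback_lift (sq : IsPullback fst snd f g) {K : Type} [MetricSpace K]
    [CompactSpace K] [ConnectedSpace K] [LocallyConnectedSpace K] (a : C(K, ((ihom A).obj X).obj))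
    (b : C(K, ((ihom A).obj Y).obj)) (h : ∀ k, homMap A f (a k) = homMap A g (b k)) :
    ∃ c : C(K, ((ihom A).obj P).obj),
      (∀ k, homMap A fst (c k) = a k) ∧ ∀ k, homMap A snd (c k) = b k := by
  have : PreservesLimitsOfSize.{0, 0} (ihom A) := (ihom.adjunction A).rightAdjoint_preservesLimits
  have sq' := sq.map (ihom A)
  let toHom : ∀ {W : Unif.{u}}, C(K, W.obj) → (Unif.ofCompact K ⟶ W) := fun c =>
    Unif.mkHom (X := Unif.ofCompact K) (fun k => c k.down)
      ((CompactSpace.uniformContinuous_of_continuous c.continuous).comp uniformContinuous_uliftDown)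
  let l := sq'.lift (toHom a) (toHom b) (Unif.hom_ext fun k => h k.down)
  refine ⟨(Unif.toMap l).comp ⟨ULift.up, continuous_uliftUp⟩, fun k => ?_, fun k => ?_⟩
  · exact Unif.toMap_congr (sq'.lift_fst (toHom a) (toHom b) _) (ULift.up k)
  · exact Unif.toMap_congr (sq'.lift_snd (toHom a) (toHom b) _) (ULift.up k)

theorem fibrations_of_isPullback (sq : IsPullback fst snd f g)
    (hf : uniformHurewiczFibrations f) : uniformHurewiczFibrations snd := by
  intro A γ p hp
  have hw : homMap A f (homMap A fst p) = homMap A g (homMap A snd p) := by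
    rw [← ContinuousMap.comp_apply, ← ContinuousMap.comp_apply, ← homMap_comp, ← homMap_comp, sq.w]
  obtain ⟨γ₁, h0, h1⟩ := hf A ((homMap A g).comp γ) (homMap A fst p) (by
    rw [hw, hp, ContinuousMap.comp_apply])
  obtain ⟨c, hc1, hc2⟩ := exists_pullback_lift sq γ₁ γ fun k => DFunLike.congr_fun h1 k
  exact ⟨c, homMap_pullback_ext sq ((hc1 0).trans h0) ((hc2 0).trans hp.symm),
    ContinuousMap.ext hc2⟩

theorem weakEquivalences_of_isPullback (sq : IsPullback fst snd f g)
    (hf : uniformHurewiczFibrations f) (hw : uniformWeakEquivalences f) :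
    uniformWeakEquivalences snd := by
  intro C
  rw [isClassicalWeakEquiv_homMap_iff]
  intro D
  have hsq : ∀ p, homMap (uniformRealization C ⊗ fineRealization D) f (homMap _ fst p) =
      homMap (uniformRealization C ⊗ fineRealization D) g (homMap _ snd p) := fun p => by
    rw [← ContinuousMap.comp_apply, ← ContinuousMap.comp_apply, ← homMap_comp, ← homMap_comp, sq.w]
  refine ⟨fun p₀ p₁ ⟨γ⟩ => ?_, fun y => ?_⟩
  · obtain ⟨δ, hδ⟩ := exists_lift_path hf (hw C) D
      ((γ.map (homMap _ g).continuous).cast (hsq p₀) (hsq p₁))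
    obtain ⟨c, hc1, hc2⟩ := exists_pullback_lift sq δ.toContinuousMap γ.toContinuousMap hδ
    refine ⟨⟨c, homMap_pullback_ext sq ?_ ?_, homMap_pullback_ext sq ?_ ?_⟩⟩
    · exact (hc1 0).trans δ.source
    · exact (hc2 0).trans γ.source
    · exact (hc1 1).trans δ.target
    · exact (hc2 1).trans γ.target
  · obtain ⟨x, hx⟩ := (hf _).surjective ((isClassicalWeakEquiv_homMap_iff f).1 (hw C) D).2
      (homMap (uniformRealization C ⊗ fineRealization D) g y)
    obtain ⟨c, -, hc2⟩ := exists_pullback_lift sq (K := Unit) (ContinuousMap.const _ x)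
      (ContinuousMap.const _ y) fun _ => hx
    exact ⟨c (), (hc2 ()).symm ▸ Joined.refl _⟩

end Pullback

theorem fibrations_baseChange : (uniformHurewiczFibrations.{u}).IsStableUnderBaseChange where
  of_isPullback sq hg := fibrations_of_isPullback sq hg

theorem acyclicFibrations_baseChange :
    (uniformHurewiczFibrations.{u} ⊓ uniformWeakEquivalences).IsStableUnderBaseChange where
  of_isPullback sq hg :=
    ⟨fibrations_of_isPullback sq hg.1, weakEquivalences_of_isPullback sq hg.1 hg.2⟩

theorem fibrations_of_isTerminal {T : Unif.{u}} (hT : IsTerminal T) (f : X ⟶ T) :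
    uniformHurewiczFibrations f := by
  intro A γ x _
  have hsub : ∀ t t' : T.obj, t = t' := fun t t' =>
    Unif.toMap_congr (hT.hom_ext (Unif.const t) (Unif.const t')) PUnit.unit
  exact ⟨ContinuousMap.const _ x, rfl, ContinuousMap.ext fun _ => Unif.ev_ext fun _ => hsub _ _⟩

/-! ### Path objects -/

section PathObject

/-- The unit interval as an object of `Unif`. -/
abbrev Unif.interval : Unif.{u} := Unif.ofCompact I

/-- A time as a point of the interval object. -/
def Unif.time (t : I) : Unif.interval.{u}.obj := ULift.up t

/-- Evaluation of paths at time `t`. -/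
def pathEval (X : Unif.{u}) (t : I) : (ihom Unif.interval).obj X ⟶ X :=
  Unif.mkHom (fun φ => Unif.ev φ (Unif.time t)) <|
    Unif.uniformContinuous_of_test _ fun _ _ hM hg =>
      Unif.uniformContinuous_ev hM hg uniformContinuous_const

theorem toMap_pathEval (t : I) (φ : ((ihom Unif.interval).obj X).obj) :
    Unif.toMap (pathEval X t) φ = Unif.ev φ (Unif.time t) := rfl

/-- The inclusion of the constant paths. -/
def constPath (X : Unif.{u}) : X ⟶ (ihom Unif.interval).obj X :=
  Unif.expMk (fun x _ => x) fun _ _ _ _ ht _ => ht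

theorem ev_constPath (x : X.obj) (r : Unif.interval.{u}.obj) :
    Unif.ev (Unif.toMap (constPath X) x) r = x :=
  Unif.ev_expMk _ _ x r

theorem constPath_pathEval (X : Unif.{u}) (t : I) : constPath X ≫ pathEval X t = 𝟙 X :=
  Unif.hom_ext fun x => by rw [Unif.toMap_comp, toMap_pathEval, ev_constPath, Unif.toMap_id]

theorem pathSpace_ext {θ θ' : ((ihom A).obj ((ihom Unif.interval).obj X)).obj}
    (h : ∀ a t, Unif.ev (Unif.ev θ a) (Unif.time t) = Unif.ev (Unif.ev θ' a) (Unif.time t)) :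
    θ = θ' :=
  Unif.ev_ext fun a => Unif.ev_ext fun r => h a r.down

/-- A square in `X ^ A` is a path in the exponential of `A` and the path object of `X`. -/
theorem exists_path_of_square (L : C(I × I, ((ihom A).obj X).obj)) :
    ∃ γ : C(I, ((ihom A).obj ((ihom Unif.interval).obj X)).obj),
      ∀ s a t, Unif.ev (Unif.ev (γ s) a) (Unif.time t) = Unif.ev (L (s, t)) a := by
  have hL := Unif.continuous_exp_iff.1 L.continuous
  choose φ hφ using fun (s : I) (a : A.obj) => Unif.exists_ev_eq (A := Unif.interval) (X := X)
    (fun r => Unif.ev (L (s, r.down)) a) <| Unif.uniformContinuous_of_test _ fun M g hM hg =>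
      hL M hM (fun m => (s, (g m).down)) (fun _ => a)
        (uniformContinuous_const.prodMk (uniformContinuous_uliftDown.comp hg))
        uniformContinuous_const
  obtain ⟨γ, hγ⟩ := Unif.exists_continuousMap_exp (K := I) (θ := φ) fun N hN t a ht ha => by
    refine (Unif.uniformContinuous_exp_iff (B := Unif.ofTest N hN)).2 fun M hM m r hm hr => ?_
    simp only [hφ]
    exact hL M hM (fun k => (t (m k), (r k).down)) (fun k => a (m k))
      ((ht.comp hm).prodMk (uniformContinuous_uliftDown.comp hr)) (ha.comp hm)
  exact ⟨γ, fun s a t => by rw [hγ, hφ]; rfl⟩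

/-- A point of the exponential of `A` and the path object of `X` is a path in `X ^ A`. -/
theorem exists_path_of_point (θ : ((ihom A).obj ((ihom Unif.interval).obj X)).obj) :
    ∃ g : C(I, ((ihom A).obj X).obj),
      ∀ t a, Unif.ev (g t) a = Unif.ev (Unif.ev θ a) (Unif.time t) :=
  Unif.exists_continuousMap_exp (K := I)
    (θ := fun t a => Unif.ev (Unif.ev θ a) (Unif.time t)) fun _ hN _ _ ht ha =>
      Unif.uniformContinuous_ev hN (Unif.uniformContinuous_ev hN uniformContinuous_const ha)
        (uniformContinuous_uliftUp.comp ht)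

/-- Paths contract to their starting points. -/
theorem constPath_mem_weakEquivalences (X : Unif.{u}) : uniformWeakEquivalences (constPath X) := by
  intro C
  rw [isClassicalWeakEquiv_homMap_iff]
  intro D
  set A := uniformRealization C ⊗ fineRealization D
  have hr : (homMap A (pathEval X 0)).comp (homMap A (constPath X)) = ContinuousMap.id _ := by
    rw [← homMap_comp, constPath_pathEval, homMap_id]
  refine ⟨fun p₀ p₁ h => ?_, fun η => ⟨homMap A (pathEval X 0) η, ?_⟩⟩
  · have := h.map (homMap A (pathEval X 0)).continuous
    rwa [← ContinuousMap.comp_apply, ← ContinuousMap.comp_apply, hr] at this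
  · obtain ⟨g, hg⟩ := exists_path_of_point η
    obtain ⟨γ, hγ⟩ := exists_path_of_square
      (⟨fun p => g (p.1 * p.2), g.continuous.comp continuous_mul⟩ : C(I × I, _))
    refine ⟨⟨γ, pathSpace_ext fun a t => ?_, pathSpace_ext fun a t => ?_⟩⟩
    · rw [ContinuousMap.toFun_eq_coe, hγ, Unif.ev_homMap, ev_constPath, Unif.ev_homMap,
        toMap_pathEval, ContinuousMap.coe_mk, zero_mul, hg]
    · rw [ContinuousMap.toFun_eq_coe, hγ, ContinuousMap.coe_mk, one_mul, hg]

/-- The evaluation of paths at both end points is a fibration.  The target `Q` stands for `X × X`: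
all that matters is that its projections are jointly injective on points. -/
theorem fibrations_of_pathEval {Q : Unif.{u}} {p₀ p₁ : Q ⟶ X}
    (hQ : ∀ x y : Q.obj, Unif.toMap p₀ x = Unif.toMap p₀ y →
      Unif.toMap p₁ x = Unif.toMap p₁ y → x = y) (e : (ihom Unif.interval).obj X ⟶ Q)
    (he0 : e ≫ p₀ = pathEval X 0) (he1 : e ≫ p₁ = pathEval X 1) :
    uniformHurewiczFibrations e := by
  intro A γ θ hθ
  have hend0 : ∀ (η : ((ihom A).obj ((ihom Unif.interval).obj X)).obj) (a : A.obj),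
      Unif.toMap p₀ (Unif.ev (homMap A e η) a) = Unif.ev (Unif.ev η a) (Unif.time 0) := fun η a => by
    rw [Unif.ev_homMap, ← Unif.toMap_comp, he0, toMap_pathEval]
  have hend1 : ∀ (η : ((ihom A).obj ((ihom Unif.interval).obj X)).obj) (a : A.obj),
      Unif.toMap p₁ (Unif.ev (homMap A e η) a) = Unif.ev (Unif.ev η a) (Unif.time 1) := fun η a => by
    rw [Unif.ev_homMap, ← Unif.toMap_comp, he1, toMap_pathEval]
  obtain ⟨g, hg⟩ := exists_path_of_point θ
  obtain ⟨L, hL, hL0, hL1⟩ := exists_square g ((homMap A p₀).comp γ) ((homMap A p₁).comp γ)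
    (Unif.ev_ext fun a => by rw [ContinuousMap.comp_apply, ← hθ, Unif.ev_homMap, hend0, hg])
    (Unif.ev_ext fun a => by rw [ContinuousMap.comp_apply, ← hθ, Unif.ev_homMap, hend1, hg])
  obtain ⟨γ', hγ'⟩ := exists_path_of_square L
  refine ⟨γ', pathSpace_ext fun a t => by rw [hγ', hL, hg], ContinuousMap.ext fun s =>
    Unif.ev_ext fun a => hQ _ _ ?_ ?_⟩
  · rw [ContinuousMap.comp_apply, hend0, hγ', hL0, ContinuousMap.comp_apply, Unif.ev_homMap]
  · rw [ContinuousMap.comp_apply, hend1, hγ', hL1, ContinuousMap.comp_apply, Unif.ev_homMap]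

theorem exists_pathObject [HasFiniteLimits Unif.{u}] (X : Unif.{u}) :
    ∃ (P : Unif.{u}) (i : X ⟶ P) (p : P ⟶ X ⨯ X),
      uniformWeakEquivalences i ∧ uniformHurewiczFibrations p ∧ i ≫ p = diag X := by
  refine ⟨_, constPath X, prod.lift (pathEval X 0) (pathEval X 1),
    constPath_mem_weakEquivalences X,
    fibrations_of_pathEval (p₀ := prod.fst) (p₁ := prod.snd) (fun x y h0 h1 => ?_) _
      (prod.lift_fst _ _) (prod.lift_snd _ _), ?_⟩
  · have : Unif.const x = Unif.const y :=
      Limits.prod.hom_ext (Unif.hom_ext fun _ => h0) (Unif.hom_ext fun _ => h1)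
    exact Unif.toMap_congr this PUnit.unit
  · refine Limits.prod.hom_ext ?_ ?_
    · rw [Category.assoc, prod.lift_fst, constPath_pathEval, prod.lift_fst]
    · rw [Category.assoc, prod.lift_snd, constPath_pathEval, prod.lift_snd]

end PathObject

end Fibrant

end UniformHomotopy

theorem mainTheorem6 :
    (∃ _ : CartesianMonoidalCategory UniformHomotopy.Unif.{u},
      Nonempty (MonoidalClosed UniformHomotopy.Unif.{u})) ∧
    ∀ [CartesianMonoidalCategory UniformHomotopy.Unif.{u}]
      [MonoidalClosed UniformHomotopy.Unif.{u}],
      UniformHomotopy.IsCategoryOfFibrantObjects UniformHomotopy.Unif.{u}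
        UniformHomotopy.uniformWeakEquivalences UniformHomotopy.uniformHurewiczFibrations := by
  refine ⟨UniformHomotopy.Unif.exists_cartesianClosed, fun {_} {_} => ?_⟩
  have := UniformHomotopy.Unif.hasFiniteLimits.{u}
  exact
    { hasFiniteLimits := UniformHomotopy.Unif.hasFiniteLimits
      weq_of_isIso := UniformHomotopy.weakEquivalences_of_isIso
      fib_of_isIso := UniformHomotopy.fibrations_of_isIso
      fib_comp := UniformHomotopy.fibrations_comp
      twoOutOfThree := UniformHomotopy.weakEquivalences_twoOutOfThree
      factor_diag := UniformHomotopy.exists_pathObject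
      fib_terminal := fun _ => UniformHomotopy.fibrations_of_isTerminal terminalIsTerminal _
      fib_baseChange := UniformHomotopy.fibrations_baseChange
      acyclicFib_baseChange := UniformHomotopy.acyclicFibrations_baseChange }
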